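/- Let $(\mathfrak g,\mathfrak q)$ be a CR-algebra, i.e. $\mathfrak g$ is a finite-dimensional real Lie algebra and $\mathfrak q$ is a complex Lie subalgebra of its complexification $\mathfrak l=\mathfrak g\otimes_{\mathbb R}\mathbb C$. Let $\sigma:\mathfrak l\to\mathfrak l$ be the complex conjugation fixing $\mathfrak g$, and put $\mathfrak H=(\mathfrak q+\sigma\mathfrak q)\cap\mathfrak g$. Let $(M,o)$ be the associated CR-germ, defined as follows. Let $Z$ represent the germ at $o$ of a complex manifold with a transitive holomorphic infinitesimal action of $\mathfrak l$ with isotropy $\mathfrak q$ at $o$; that is, there is a homomorphism $\Xi$ of complex Lie algebras from $\mathfrak l$ to the holomorphic vector fields on $Z$ such that $v\mapsto\Xi(v)_z$ maps $\mathfrak l$ onto $T_zZ$ for every $z\in Z$, and $\mathfrak q=\{v\in\mathfrak l:\Xi(v)_o=0\}$. Then $M\subset Z$ is a representative of the germ at $o$ of the Nagano leaf of $\Xi(\mathfrak g)$ through $o$, i.e. a real-analytic (locally closed) submanifold of $Z$ containing $o$ with $T_xM=\{\Xi(v)_x:v\in\mathfrak g\}$ for all $x\in M$. Its CR-structure is the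 one induced from $Z$, with complex tangent spaces $\mathcal H_x=T_xM\cap iT_xM$. Call $M$ minimal at $o$ if every locally closed smooth submanifold $Y\subset M$ with $o\in Y$ and $\mathcal H_y\subset T_yY$ for all $y\in Y$ satisfies $T_oY=T_oM$. Then $M$ is minimal at $o$ if and only if the smallest Lie subalgebra of $\mathfrak g$ containing $\mathfrak H$ is $\mathfrak g$ itself. -/

import Mathlib

open scoped TensorProduct ContDiff Topology

noncomputable section

namespace CRAlg

section Algebra

variable {𝔤 : Type*} [LieRing 𝔤] [LieAlgebra ℝ 𝔤]

/-- The complex conjugation `σ` of the complexification `ℂ ⊗ 𝔤` with fixed points `𝔤`, that is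
`σ (z ⊗ v) = conj z ⊗ v`, as a real-linear map. -/
def conjugation (𝔤 : Type*) [LieRing 𝔤] [LieAlgebra ℝ 𝔤] : (ℂ ⊗[ℝ] 𝔤) →ₗ[ℝ] (ℂ ⊗[ℝ] 𝔤) :=
  TensorProduct.map Complex.conjAe.toLinearMap LinearMap.id

/-- The real subspace `(𝔮 + σ 𝔮) ∩ 𝔤` of `𝔤`, where `𝔤` sits in `ℂ ⊗ 𝔤` through `v ↦ 1 ⊗ v`. -/
def holomorphicPart (𝔮 : LieSubalgebra ℂ (ℂ ⊗[ℝ] 𝔤)) : Submodule ℝ 𝔤 :=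
  (𝔮.toSubmodule.restrictScalars ℝ ⊔
    (𝔮.toSubmodule.restrictScalars ℝ).map (conjugation 𝔤)).comap (TensorProduct.mk ℝ ℂ 𝔤 1)

end Algebra

section Submanifolds

variable {E : Type*} [NormedAddCommGroup E]

/-- `S` is a locally closed embedded `C^k` submanifold of the real vector space `E`: around each of
its points there is a local `C^k` diffeomorphism of `E` that straightens `S` to a linear
subspace. -/
def IsSubmanifold [NormedSpace ℝ E] (k : WithTop ℕ∞) (S : Set E) : Prop :=
  ∀ x ∈ S, ∃ (φ : OpenPartialHomeomorph E E) (F : Submodule ℝ E),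
    x ∈ φ.source ∧ ContDiffOn ℝ k φ φ.source ∧ ContDiffOn ℝ k φ.symm φ.target ∧
      ∀ y ∈ φ.source, y ∈ S ↔ φ y ∈ F

/-- The tangent space `T_x S`: the (span of the) velocities at `x` of curves that run in `S`.
When `S` is a submanifold, the velocities already form a linear subspace. -/
def tangentSpaceAt [NormedSpace ℝ E] (S : Set E) (x : E) : Submodule ℝ E :=
  Submodule.span ℝ {v | ∃ γ : ℝ → E, γ 0 = x ∧ HasDerivAt γ v 0 ∧ ∀ᶠ t in 𝓝 (0 : ℝ), γ t ∈ S}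

variable [NormedSpace ℂ E]

/-- The complex tangent space `T_x M ∩ i T_x M` (a vector `v` of `T_x M` lies in `i T_x M` exactly
when `i v` lies in `T_x M`). -/
def complexTangentSpaceAt (M : Set E) (x : E) : Submodule ℝ E :=
  tangentSpaceAt M x ⊓
    (tangentSpaceAt M x).comap ((Complex.I • (LinearMap.id : E →ₗ[ℂ] E)).restrictScalars ℝ)

/-- The embedded CR-manifold `M` is minimal at `o`: every submanifold `Y ⊆ M` through `o` that is
tangent to all complex tangent spaces of `M` at its points has the full tangent space at `o`. -/
def IsMinimalAt (M : Set E) (o : E) : Prop :=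
  ∀ Y : Set E, Y ⊆ M → IsSubmanifold ∞ Y → o ∈ Y →
    (∀ y ∈ Y, complexTangentSpaceAt M y ≤ tangentSpaceAt Y y) →
      tangentSpaceAt Y o = tangentSpaceAt M o

end Submanifolds

section Germs

variable {𝔩 : Type*} [LieRing 𝔩] [LieAlgebra ℂ 𝔩]
  {E : Type*} [NormedAddCommGroup E] [NormedSpace ℂ E]

/-- `Z`, in a holomorphic chart an open neighbourhood of `o` in a complex vector space, with the
transitive holomorphic infinitesimal action `Ξ` of the complex Lie algebra `𝔩`, represents the
homogeneous complex germ with infinitesimal model `𝔩 / 𝔮`. -/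
structure IsHomogeneousModel (𝔮 : LieSubalgebra ℂ 𝔩) (Z : Set E) (o : E)
    (Ξ : 𝔩 →ₗ[ℂ] (E → E)) : Prop where
  isOpen : IsOpen Z
  base_mem : o ∈ Z
  holomorphic : ∀ v, AnalyticOnNhd ℂ (Ξ v) Z
  map_lie : ∀ v w, ∀ z ∈ Z, Ξ ⁅v, w⁆ z = VectorField.lieBracket ℂ (Ξ v) (Ξ w) z
  transitive : ∀ z ∈ Z, Function.Surjective fun v => Ξ v z
  isotropy : ∀ v, Ξ v o = 0 ↔ v ∈ 𝔮

/-- `M` represents the germ at `o` of the real-analytic Nagano leaf through `o` in `Z` of the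
vector fields `Ξ (1 ⊗ v)`, `v ∈ 𝔤`: a real-analytic submanifold through `o` whose tangent spaces
consist of the values of these vector fields. -/
structure IsNaganoLeaf {𝔤 : Type*} [LieRing 𝔤] [LieAlgebra ℝ 𝔤] (Z : Set E) (o : E)
    (Ξ : (ℂ ⊗[ℝ] 𝔤) →ₗ[ℂ] (E → E)) (M : Set E) : Prop where
  subset : M ⊆ Z
  base_mem : o ∈ M
  isSubmanifold : IsSubmanifold ω M
  tangentSpace_eq : ∀ x ∈ M,
    (tangentSpaceAt M x : Set E) = Set.range fun v : 𝔤 => Ξ ((1 : ℂ) ⊗ₜ[ℝ] v) x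

/-- `(M, o)`, embedded in `Z` with the action `Ξ`, represents the CR-germ associated with the
CR-algebra `(𝔤, 𝔮)`. -/
structure IsAssociatedCRGerm {𝔤 : Type*} [LieRing 𝔤] [LieAlgebra ℝ 𝔤]
    (𝔮 : LieSubalgebra ℂ (ℂ ⊗[ℝ] 𝔤)) (Z : Set E) (o : E)
    (Ξ : (ℂ ⊗[ℝ] 𝔤) →ₗ[ℂ] (E → E)) (M : Set E) : Prop where
  model : IsHomogeneousModel 𝔮 Z o Ξ
  leaf : IsNaganoLeaf Z o Ξ M

end Germs

end CRAlg

end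

/-! Write `X_v` for the field `realAction Ξ v` and `𝔞` for the Lie subalgebra generated by
`holomorphicPart 𝔮`.

Suppose `𝔞 = 𝔤`. Consider the `v` for which `X_v` agrees at `o` with a field generated by brackets
from sections of the complex tangent spaces. They include the holomorphic part
(`exists_bracketGenerated`). They form a subalgebra: each `X_v` is an infinitesimal CR-automorphism,
so bracketing with it preserves bracket-generated fields (`lieBracket_left`), and the bracket of two
fields that vanish at `o` vanishes at `o` (`exists_lieBracket_eq`). Hence every `v` qualifies.
Bracket-generated fields are tangent to every competing `Y`, so `T_oY = T_oM`.

Conversely, let `Y` be a local orbit of `𝔞` through `o` (`exists_isSubmanifold_orbit`); it lies in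
`M`. Let `X_v(y)` be a complex tangent vector at the endpoint `y` of a trajectory of some `a ∈ 𝔞`.
The flow is holomorphic and acts on `𝔤` by the exponential of the bracket with `a`, so pulling back
to `o` moves `v` into the holomorphic part (`exp_neg_mem_holomorphicPart`); as this exponential
preserves `𝔞`, also `v ∈ 𝔞`. Thus `Y` competes, and minimality gives `T_oY = T_oM`: each element of
`𝔤` differs from one of `𝔞` by a real isotropy element, which lies in the holomorphic part.

The orbit is the image of the time-one endpoint map on a complement of the isotropy in `𝔞`. This map
is an immersion, and its image is tangent to exactly the values of `𝔞` because their rank cannot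
grow along trajectories. -/

namespace CRAlg

/-! ### Tangent spaces of submanifolds and brackets of tangent fields. -/

section Tangent

variable {E : Type*} [NormedAddCommGroup E] [NormedSpace ℝ E]
  {G : Type*} [NormedAddCommGroup G] [NormedSpace ℝ G]

/-- It suffices to test velocities, where `g ∘ γ` is locally zero. This is how equations valid only
along `S` get differentiated. -/
theorem fderiv_eq_zero_of_mem_tangentSpaceAt {S : Set E} {x : E} {g : E → G}
    (hg : DifferentiableAt ℝ g x) (h0 : ∀ᶠ y in 𝓝 x, y ∈ S → g y = 0) {v : E}
    (hv : v ∈ tangentSpaceAt S x) : fderiv ℝ g x v = 0 := by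
  suffices h : tangentSpaceAt S x ≤ LinearMap.ker (fderiv ℝ g x).toLinearMap from h hv
  refine Submodule.span_le.2 ?_
  rintro w ⟨γ, rfl, hγ, hS⟩
  have h1 : HasDerivAt (g ∘ γ) (fderiv ℝ g (γ 0) w) 0 := hg.hasFDerivAt.comp_hasDerivAt 0 hγ
  have h2 : (g ∘ γ) =ᶠ[𝓝 0] fun _ => 0 := by
    filter_upwards [hS, hγ.continuousAt.eventually h0] with t h3 h4 using h4 h3
  exact h1.unique ((hasDerivAt_const (0 : ℝ) (0 : G)).congr_of_eventuallyEq h2)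

theorem mem_tangentSpaceAt_of_hasDerivAt {S : Set E} {x v : E} {γ : ℝ → E} (h0 : γ 0 = x)
    (hγ : HasDerivAt γ v 0) (hS : ∀ᶠ t in 𝓝 (0 : ℝ), γ t ∈ S) : v ∈ tangentSpaceAt S x :=
  Submodule.subset_span ⟨γ, h0, hγ, hS⟩

theorem tangentSpaceAt_mono {S T : Set E} (h : S ⊆ T) (x : E) :
    tangentSpaceAt S x ≤ tangentSpaceAt T x := by
  refine Submodule.span_mono ?_
  rintro v ⟨γ, h0, hγ, hS⟩
  exact ⟨γ, h0, hγ, hS.mono fun t ht => h ht⟩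

variable [FiniteDimensional ℝ E]

/-- Turns membership in `F` into an equation that can be differentiated. -/
theorem exists_ker_eq (F : Submodule ℝ E) : ∃ q : E →L[ℝ] E, LinearMap.ker q.toLinearMap = F := by
  obtain ⟨N, hN⟩ := F.exists_isCompl
  refine ⟨LinearMap.toContinuousLinearMap (N.subtype ∘ₗ N.projectionOnto F hN.symm), ?_⟩
  ext x
  simp

/-- The tangent space of a submanifold read in a straightening chart. -/
theorem mem_tangentSpaceAt_iff {S : Set E} {φ : OpenPartialHomeomorph E E} {F : Submodule ℝ E}
    {k : WithTop ℕ∞} (hk : 1 ≤ k) (hφ : ContDiffOn ℝ k φ φ.source)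
    (hφ' : ContDiffOn ℝ k φ.symm φ.target) (hS : ∀ y ∈ φ.source, y ∈ S ↔ φ y ∈ F)
    {x : E} (hx : x ∈ φ.source) (hxS : x ∈ S) {v : E} :
    v ∈ tangentSpaceAt S x ↔ fderiv ℝ φ x v ∈ F := by
  have hk0 : k ≠ 0 := by rintro rfl; simp at hk
  have hd : DifferentiableAt ℝ φ x :=
    (hφ.contDiffAt (φ.open_source.mem_nhds hx)).differentiableAt hk0
  have hd' : DifferentiableAt ℝ φ.symm (φ x) :=
    (hφ'.contDiffAt (φ.open_target.mem_nhds (φ.map_source hx))).differentiableAt hk0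
  have hinv : (fderiv ℝ φ.symm (φ x)).comp (fderiv ℝ φ x) = ContinuousLinearMap.id ℝ E := by
    have h1 := hd'.hasFDerivAt.comp x hd.hasFDerivAt
    refine h1.unique ((hasFDerivAt_id x).congr_of_eventuallyEq ?_)
    filter_upwards [φ.open_source.mem_nhds hx] with y hy using φ.left_inv hy
  obtain ⟨q, hq⟩ := exists_ker_eq F
  constructor
  · intro hv
    have h1 := fderiv_eq_zero_of_mem_tangentSpaceAt (g := fun y => q (φ y))
      (q.differentiableAt.comp x hd) (by
        filter_upwards [φ.open_source.mem_nhds hx] with y hy hyS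
        have := (hS y hy).1 hyS
        rw [← hq] at this
        exact this) hv
    rw [show (fun y => q (φ y)) = q ∘ φ from rfl, fderiv_comp x q.differentiableAt hd] at h1
    rw [← hq]
    simpa using h1
  · intro hv
    have hxF := (hS x hx).1 hxS
    have hl : HasDerivAt (fun t : ℝ => φ x + t • fderiv ℝ φ x v) (fderiv ℝ φ x v) 0 := by
      simpa using ((hasDerivAt_id (0 : ℝ)).smul_const (fderiv ℝ φ x v)).const_add (φ x)
    refine mem_tangentSpaceAt_of_hasDerivAt
      (γ := fun t => φ.symm (φ x + t • fderiv ℝ φ x v)) (by simp [φ.left_inv hx]) ?_ ?_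
    · have h2 : HasFDerivAt φ.symm (fderiv ℝ φ.symm (φ x)) (φ x + (0 : ℝ) • fderiv ℝ φ x v) := by
        simpa using hd'.hasFDerivAt
      have h3 := h2.comp_hasDerivAt (0 : ℝ) hl
      have h4 : fderiv ℝ φ.symm (φ x) (fderiv ℝ φ x v) = v := by
        simpa using congrArg (fun T : E →L[ℝ] E => T v) hinv
      rwa [h4] at h3
    · have h5 : ∀ᶠ t in 𝓝 (0 : ℝ), φ x + t • fderiv ℝ φ x v ∈ φ.target :=
        hl.continuousAt.eventually (by
          simpa using φ.open_target.mem_nhds (φ.map_source hx))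
      filter_upwards [h5] with t ht
      rw [hS _ (φ.map_target ht), φ.right_inv ht]
      exact F.add_mem hxF (F.smul_mem _ hv)

/-- The Lie bracket of two vector fields tangent to a submanifold is tangent to it. -/
theorem lieBracket_mem_tangentSpaceAt {S : Set E} {k : WithTop ℕ∞} (hk : 2 ≤ k)
    (hS : IsSubmanifold k S) {x : E} (hx : x ∈ S) {V W : E → E}
    (hV : DifferentiableAt ℝ V x) (hW : DifferentiableAt ℝ W x)
    (hVS : ∀ᶠ y in 𝓝 x, y ∈ S → V y ∈ tangentSpaceAt S y)
    (hWS : ∀ᶠ y in 𝓝 x, y ∈ S → W y ∈ tangentSpaceAt S y) :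
    VectorField.lieBracket ℝ V W x ∈ tangentSpaceAt S x := by
  obtain ⟨φ, F, hxφ, hφ, hφ', hSF⟩ := hS x hx
  have hk1 : 1 ≤ k := le_trans (by norm_num) hk
  have hk0 : k ≠ 0 := by rintro rfl; simp at hk1
  obtain ⟨q, hq⟩ := exists_ker_eq F
  have hφx : ContDiffAt ℝ k φ x := hφ.contDiffAt (φ.open_source.mem_nhds hxφ)
  have hfd : DifferentiableAt ℝ (fderiv ℝ φ) x :=
    (hφx.fderiv_right (m := 1) (by simpa [one_add_one_eq_two] using hk)).differentiableAt (by simp)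
  rw [mem_tangentSpaceAt_iff hk1 hφ hφ' hSF hxφ hx]
  -- In the chart a tangent field has values in `F` along `S`, so its derivatives in tangent
  -- directions stay in `F`. The bracket is a difference of two such derivatives.
  have key : ∀ U : E → E, DifferentiableAt ℝ U x →
      (∀ᶠ y in 𝓝 x, y ∈ S → U y ∈ tangentSpaceAt S y) → ∀ w ∈ tangentSpaceAt S x,
      fderiv ℝ (fun y => fderiv ℝ φ y (U y)) x w ∈ F := by
    intro U hU hUS w hw
    have hdiff : DifferentiableAt ℝ (fun y => fderiv ℝ φ y (U y)) x := hfd.clm_apply hU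
    have h1 := fderiv_eq_zero_of_mem_tangentSpaceAt
      (g := fun y => q (fderiv ℝ φ y (U y))) (q.differentiableAt.comp x hdiff) (by
        filter_upwards [hUS, φ.open_source.mem_nhds hxφ] with y hy hys hyS
        have := (mem_tangentSpaceAt_iff hk1 hφ hφ' hSF hys hyS).1 (hy hyS)
        rw [← hq] at this
        exact this) hw
    rw [show (fun y => q (fderiv ℝ φ y (U y))) = q ∘ (fun y => fderiv ℝ φ y (U y)) from rfl,
      fderiv_comp x q.differentiableAt hdiff] at h1
    rw [← hq]
    simpa using h1
  rw [VectorField.fderiv_apply_lieBracket hφx (by simpa using hk) hW hV]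
  exact F.sub_mem (key W hW hWS _ (hVS.self_of_nhds hx)) (key V hV hVS _ (hWS.self_of_nhds hx))

end Tangent

theorem two_le_infty : (2 : WithTop ℕ∞) ≤ ∞ :=
  WithTop.coe_le_coe.2 (le_top (a := (2 : ℕ∞)))

/-! ### Fields generated by brackets from the complex tangent spaces. -/

section BracketGenerated

variable {E : Type*} [NormedAddCommGroup E] [NormedSpace ℂ E]

/-- The germs at `o` of vector fields that arise from sections of the complex tangent spaces of `M`
by linear combinations and iterated Lie brackets. -/
inductive BracketGenerated (M : Set E) (o : E) : (E → E) → Prop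
  | of (W : E → E) (hW : ∀ᶠ x in 𝓝 o, ContDiffAt ℝ ∞ W x)
      (hWM : ∀ᶠ x in 𝓝 o, x ∈ M → W x ∈ complexTangentSpaceAt M x) : BracketGenerated M o W
  | add {V W : E → E} (hV : BracketGenerated M o V) (hW : BracketGenerated M o W) :
      BracketGenerated M o (V + W)
  | smul (c : ℝ) {V : E → E} (hV : BracketGenerated M o V) : BracketGenerated M o (c • V)
  | lie {V W : E → E} (hV : BracketGenerated M o V) (hW : BracketGenerated M o W) :
      BracketGenerated M o (VectorField.lieBracket ℝ V W)
  | congr {V W : E → E} (hV : BracketGenerated M o V) (h : W =ᶠ[𝓝 o] V) : BracketGenerated M o W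

namespace BracketGenerated

variable {M : Set E} {o : E}

theorem eventually_contDiffAt {V : E → E} (hV : BracketGenerated M o V) :
    ∀ᶠ x in 𝓝 o, ContDiffAt ℝ ∞ V x := by
  induction hV with
  | of W hW _ => exact hW
  | add _ _ h1 h2 => filter_upwards [h1, h2] with x h3 h4 using h3.add h4
  | smul c _ h1 => filter_upwards [h1] with x h2 using h2.const_smul c
  | lie _ _ h1 h2 =>
    filter_upwards [h1, h2] with x h3 h4 using h3.lieBracket_vectorField h4 (by simp)
  | congr _ h h1 =>
    filter_upwards [h1, h.eventuallyEq_nhds] with x h2 h3 using h2.congr_of_eventuallyEq h3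

theorem eventually_differentiableAt {V : E → E} (hV : BracketGenerated M o V) :
    ∀ᶠ x in 𝓝 o, DifferentiableAt ℝ V x :=
  hV.eventually_contDiffAt.mono fun _ h => h.differentiableAt (by simp)

variable [FiniteDimensional ℝ E]

/-- Tangency is claimed near `o`, not only at `o`, because the bracket step differentiates it. -/
theorem eventually_mem_tangentSpaceAt {Y : Set E} {k : WithTop ℕ∞} (hk : 2 ≤ k)
    (hY : IsSubmanifold k Y) (hYM : Y ⊆ M)
    (hHY : ∀ y ∈ Y, complexTangentSpaceAt M y ≤ tangentSpaceAt Y y)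
    {V : E → E} (hV : BracketGenerated M o V) :
    ∀ᶠ y in 𝓝 o, y ∈ Y → V y ∈ tangentSpaceAt Y y := by
  induction hV with
  | of W _ h => filter_upwards [h] with y h1 hy using hHY y hy (h1 (hYM hy))
  | add _ _ h1 h2 =>
    filter_upwards [h1, h2] with y h3 h4 hy using Submodule.add_mem _ (h3 hy) (h4 hy)
  | smul c _ h1 => filter_upwards [h1] with y h2 hy using Submodule.smul_mem _ c (h2 hy)
  | lie hV hW h1 h2 =>
    filter_upwards [h1.eventually_nhds, h2.eventually_nhds, hV.eventually_differentiableAt,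
      hW.eventually_differentiableAt] with y h3 h4 h5 h6 hy
    exact lieBracket_mem_tangentSpaceAt hk hY hy h5 h6 h3 h4
  | congr _ h h1 => filter_upwards [h, h1] with y h2 h3 hy using h2 ▸ h3 hy

/-- Bracketing with an infinitesimal CR-automorphism preserves the bracket-generated fields. -/
theorem lieBracket_left {k : WithTop ℕ∞} (hk : 2 ≤ k) (hM : IsSubmanifold k M) {X : E → E}
    (hX : ∀ᶠ x in 𝓝 o, ContDiffAt ℝ ∞ X x) (hXℂ : ∀ᶠ x in 𝓝 o, DifferentiableAt ℂ X x)
    (hXM : ∀ᶠ x in 𝓝 o, x ∈ M → X x ∈ tangentSpaceAt M x)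
    {V : E → E} (hV : BracketGenerated M o V) :
    BracketGenerated M o (VectorField.lieBracket ℝ X V) := by
  have hXd : ∀ᶠ x in 𝓝 o, DifferentiableAt ℝ X x :=
    hX.mono fun _ h => h.differentiableAt (by simp)
  induction hV with
  | of W hW hWM =>
    refine of _ ?_ ?_
    · filter_upwards [hX, hW] with x h1 h2 using h1.lieBracket_vectorField h2 (by simp)
    · filter_upwards [hXd, hXℂ, hW, hXM.eventually_nhds, hWM.eventually_nhds]
        with x h1 h2 h3 h4 h5 hx
      have h3' : DifferentiableAt ℝ W x := h3.differentiableAt (by simp)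
      refine ⟨lieBracket_mem_tangentSpaceAt hk hM hx h1 h3' h4
        (h5.mono fun y h6 hy => (h6 hy).1), ?_⟩
      -- `X` is holomorphic, so its derivative commutes with `i` and `[X, iW] = i[X, W]`; tangency
      -- of the left side is tangency of `i[X, W]`.
      have h6 : DifferentiableAt ℝ (fun y => Complex.I • W y) x := h3'.const_smul Complex.I
      have h7 := lieBracket_mem_tangentSpaceAt hk hM hx h1 h6 h4
        (h5.mono fun y h6 hy => (h6 hy).2)
      have h8 : VectorField.lieBracket ℝ X (fun y => Complex.I • W y) x =
          Complex.I • VectorField.lieBracket ℝ X W x := by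
        simp only [VectorField.lieBracket]
        rw [fderiv_fun_const_smul h3', h2.fderiv_restrictScalars ℝ]
        simp [smul_sub]
      rw [h8] at h7
      exact h7
  | add hV hW h1 h2 =>
    refine (h1.add h2).congr ?_
    filter_upwards [hV.eventually_differentiableAt, hW.eventually_differentiableAt] with x h3 h4
    exact VectorField.lieBracket_add_right h3 h4
  | smul c hV h1 =>
    refine (h1.smul c).congr ?_
    filter_upwards [hV.eventually_differentiableAt] with x h2
    exact VectorField.lieBracket_const_smul_right h2
  | lie hV hW h1 h2 =>
    refine ((h1.lie hW).add (hV.lie h2)).congr ?_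
    filter_upwards [hX, hV.eventually_contDiffAt, hW.eventually_contDiffAt] with x h3 h4 h5
    exact VectorField.leibniz_identity_lieBracket (n := ∞)
      (by simpa using two_le_infty) h3 h4 h5
  | congr _ h h1 =>
    refine h1.congr ?_
    filter_upwards [h.eventuallyEq_nhds] with x h2
    exact Filter.EventuallyEq.lieBracket_vectorField_eq (Filter.EventuallyEq.refl _ _) h2

/-- `X - V` and `X' - V'` vanish at `o`, hence so does their bracket there. Thus `[X, X'] = -[X', V]
+ [X, V'] - [V, V']` at `o`, and each term on the right is bracket-generated. -/
theorem exists_lieBracket_eq {k : WithTop ℕ∞} (hk : 2 ≤ k) (hM : IsSubmanifold k M)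
    {X X' : E → E}
    (hX : ∀ᶠ x in 𝓝 o, ContDiffAt ℝ ∞ X x) (hXℂ : ∀ᶠ x in 𝓝 o, DifferentiableAt ℂ X x)
    (hXM : ∀ᶠ x in 𝓝 o, x ∈ M → X x ∈ tangentSpaceAt M x)
    (hX' : ∀ᶠ x in 𝓝 o, ContDiffAt ℝ ∞ X' x) (hXℂ' : ∀ᶠ x in 𝓝 o, DifferentiableAt ℂ X' x)
    (hXM' : ∀ᶠ x in 𝓝 o, x ∈ M → X' x ∈ tangentSpaceAt M x)
    (hV : ∃ V, BracketGenerated M o V ∧ X o = V o)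
    (hV' : ∃ V, BracketGenerated M o V ∧ X' o = V o) :
    ∃ V, BracketGenerated M o V ∧ VectorField.lieBracket ℝ X X' o = V o := by
  obtain ⟨V, hV, hVo⟩ := hV
  obtain ⟨V', hV', hVo'⟩ := hV'
  refine ⟨_, ((lieBracket_left hk hM hX' hXℂ' hXM' hV).smul (-1)).add
    ((lieBracket_left hk hM hX hXℂ hXM hV').add ((hV.lie hV').smul (-1))), ?_⟩
  simp only [Pi.add_apply, Pi.smul_apply, VectorField.lieBracket, hVo, hVo']
  module

end BracketGenerated

end BracketGenerated

/-! ### Real and imaginary parts in the complexification. -/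

section Complexification

variable {𝔤 : Type*} [LieRing 𝔤] [LieAlgebra ℝ 𝔤]

theorem exists_eq_one_tmul_add_I_tmul (ξ : ℂ ⊗[ℝ] 𝔤) :
    ∃ a b : 𝔤, ξ = (1 : ℂ) ⊗ₜ[ℝ] a + Complex.I ⊗ₜ[ℝ] b := by
  induction ξ with
  | zero => exact ⟨0, 0, by simp⟩
  | tmul z v =>
    refine ⟨z.re • v, z.im • v, ?_⟩
    rw [← TensorProduct.smul_tmul, ← TensorProduct.smul_tmul, ← TensorProduct.add_tmul]
    congr 1
    apply Complex.ext <;> simp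
  | add x y hx hy =>
    obtain ⟨a, b, rfl⟩ := hx
    obtain ⟨a', b', rfl⟩ := hy
    exact ⟨a + a', b + b', by simp only [TensorProduct.tmul_add]; abel⟩

theorem conjugation_one_tmul_add_I_tmul (a b : 𝔤) :
    conjugation 𝔤 ((1 : ℂ) ⊗ₜ[ℝ] a + Complex.I ⊗ₜ[ℝ] b) =
      (1 : ℂ) ⊗ₜ[ℝ] a - Complex.I ⊗ₜ[ℝ] b := by
  simp [conjugation, TensorProduct.neg_tmul, sub_eq_add_neg]

/-- If `x + σ y` is real, then `x + y ∈ 𝔮` has the same real part; conversely `v` is half the sum of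
`v + iw` and its conjugate. In this form, `v` is in the holomorphic part when `X_v(o)` equals `-i
X_w(o)` for some `w`. -/
theorem mem_holomorphicPart_iff {𝔮 : LieSubalgebra ℂ (ℂ ⊗[ℝ] 𝔤)} {v : 𝔤} :
    v ∈ holomorphicPart 𝔮 ↔ ∃ w : 𝔤, (1 : ℂ) ⊗ₜ[ℝ] v + Complex.I ⊗ₜ[ℝ] w ∈ 𝔮 := by
  simp only [holomorphicPart, Submodule.mem_comap, TensorProduct.mk_apply, Submodule.mem_sup,
    Submodule.mem_map, Submodule.restrictScalars_mem, LieSubalgebra.mem_toSubmodule]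
  constructor
  · rintro ⟨x, hx, -, ⟨y, hy, rfl⟩, h⟩
    obtain ⟨a, b, rfl⟩ := exists_eq_one_tmul_add_I_tmul x
    obtain ⟨a', b', rfl⟩ := exists_eq_one_tmul_add_I_tmul y
    refine ⟨b + b', ?_⟩
    rw [conjugation_one_tmul_add_I_tmul] at h
    have h1 : (1 : ℂ) ⊗ₜ[ℝ] (a + a') + Complex.I ⊗ₜ[ℝ] (b - b') = (1 : ℂ) ⊗ₜ[ℝ] v := by
      rw [← h, TensorProduct.tmul_add, TensorProduct.tmul_sub]; abel
    have h2 := congrArg (conjugation 𝔤) h1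
    rw [conjugation_one_tmul_add_I_tmul] at h2
    have h3 : conjugation 𝔤 ((1 : ℂ) ⊗ₜ[ℝ] v) = (1 : ℂ) ⊗ₜ[ℝ] v := by simp [conjugation]
    rw [h3, ← h1] at h2
    have h4 : (2 : ℝ) • (Complex.I ⊗ₜ[ℝ] (b - b') : ℂ ⊗[ℝ] 𝔤) = 0 := by
      rw [two_smul]
      have := sub_eq_zero.2 h2
      rw [← neg_eq_zero, ← this]; abel
    have h5 := (smul_eq_zero.1 h4).resolve_left two_ne_zero
    rw [h5, add_zero] at h1
    have h6 := 𝔮.add_mem hx hy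
    convert h6 using 1
    rw [← h1, TensorProduct.tmul_add, TensorProduct.tmul_add]; abel
  · rintro ⟨w, hw⟩
    have h1 : (1 / 2 : ℝ) • ((1 : ℂ) ⊗ₜ[ℝ] v + Complex.I ⊗ₜ[ℝ] w) ∈ 𝔮 := by
      have := 𝔮.smul_mem ((1 / 2 : ℝ) : ℂ) hw
      rwa [Complex.coe_smul] at this
    refine ⟨_, h1, _, ⟨_, h1, rfl⟩, ?_⟩
    rw [map_smul, conjugation_one_tmul_add_I_tmul]
    module

end Complexification

/-! ### Local sections of the complex tangent spaces; generation implies minimality. -/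

section Sections

variable {𝔤 : Type*} [LieRing 𝔤] [LieAlgebra ℝ 𝔤]
  {E : Type*} [NormedAddCommGroup E] [NormedSpace ℂ E]
  {𝔮 : LieSubalgebra ℂ (ℂ ⊗[ℝ] 𝔤)} {Z : Set E} {o : E} {Ξ : (ℂ ⊗[ℝ] 𝔤) →ₗ[ℂ] (E → E)} {M : Set E}

theorem map_one_tmul_add_I_tmul (Ξ : (ℂ ⊗[ℝ] 𝔤) →ₗ[ℂ] (E → E)) (a b : 𝔤) (x : E) :
    Ξ ((1 : ℂ) ⊗ₜ[ℝ] a + Complex.I ⊗ₜ[ℝ] b) x =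
      Ξ ((1 : ℂ) ⊗ₜ[ℝ] a) x + Complex.I • Ξ ((1 : ℂ) ⊗ₜ[ℝ] b) x := by
  rw [show (Complex.I ⊗ₜ[ℝ] b : ℂ ⊗[ℝ] 𝔤) = Complex.I • ((1 : ℂ) ⊗ₜ[ℝ] b) by
    simp [TensorProduct.smul_tmul']]
  simp

/-- The real vector fields given by the action, as a real-linear map. -/
noncomputable def realAction (Ξ : (ℂ ⊗[ℝ] 𝔤) →ₗ[ℂ] (E → E)) : 𝔤 →ₗ[ℝ] (E → E) :=
  (Ξ.restrictScalars ℝ) ∘ₗ TensorProduct.mk ℝ ℂ 𝔤 1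

theorem realAction_apply (v : 𝔤) : realAction Ξ v = Ξ ((1 : ℂ) ⊗ₜ[ℝ] v) := rfl

theorem IsAssociatedCRGerm.mem_tangentSpaceAt (hM : IsAssociatedCRGerm 𝔮 Z o Ξ M) {x : E}
    (hx : x ∈ M) {y : E} :
    y ∈ tangentSpaceAt M x ↔ ∃ v : 𝔤, Ξ ((1 : ℂ) ⊗ₜ[ℝ] v) x = y := by
  rw [← SetLike.mem_coe, hM.leaf.tangentSpace_eq x hx]
  rfl

theorem IsAssociatedCRGerm.realAction_lie (hM : IsAssociatedCRGerm 𝔮 Z o Ξ M) (v w : 𝔤)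
    {x : E} (hx : x ∈ Z) : realAction Ξ ⁅v, w⁆ x =
      VectorField.lieBracket ℝ (realAction Ξ v) (realAction Ξ w) x := by
  have h1 := hM.model.map_lie ((1 : ℂ) ⊗ₜ[ℝ] v) ((1 : ℂ) ⊗ₜ[ℝ] w) x hx
  have hd : ∀ u : 𝔤, DifferentiableAt ℂ (realAction Ξ u) x := fun u =>
    (hM.model.holomorphic _ x hx).differentiableAt
  rw [LieAlgebra.ExtendScalars.bracket_tmul, one_mul] at h1
  simp only [VectorField.lieBracket, (hd _).fderiv_restrictScalars ℝ]
  exact h1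

variable [FiniteDimensional ℂ E]

theorem IsHomogeneousModel.contDiffAt {𝔩 : Type*} [LieRing 𝔩] [LieAlgebra ℂ 𝔩]
    {𝔮 : LieSubalgebra ℂ 𝔩} {Ξ : 𝔩 →ₗ[ℂ] (E → E)} (h : IsHomogeneousModel 𝔮 Z o Ξ) (v : 𝔩)
    {x : E} (hx : x ∈ Z) : ContDiffAt ℂ ω (Ξ v) x :=
  (h.holomorphic v x hx).contDiffAt

/-- The vector field of an isotropy element at `o` is near `o` a combination of fields of the action
with holomorphic coefficients that vanish at `o`. -/
theorem IsHomogeneousModel.exists_coefficients {𝔩 : Type*} [LieRing 𝔩] [LieAlgebra ℂ 𝔩]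
    {𝔮 : LieSubalgebra ℂ 𝔩} {Ξ : 𝔩 →ₗ[ℂ] (E → E)} (h : IsHomogeneousModel 𝔮 Z o Ξ) {ξ : 𝔩}
    (hξ : ξ ∈ 𝔮) : ∃ (n : ℕ) (ℓ : Fin n → 𝔩) (c : Fin n → E → ℂ),
      (∀ j, ContDiffAt ℂ ω (c j) o) ∧ (∀ j, c j o = 0) ∧
      ∀ᶠ x in 𝓝 o, ∑ j, c j x • Ξ (ℓ j) x = Ξ ξ x := by
  let b := Module.finBasis ℂ E
  choose ℓ hℓ using fun j => h.transitive o h.base_mem (b j)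
  -- `A x` sends the basis vector `b j` to `Ξ (ℓ j) x`. Since `A o = id`, it is invertible near `o`,
  -- and the coefficients are the coordinates of `(A x)⁻¹ (Ξ ξ x)`.
  let A : E → E →L[ℂ] E := fun x => ∑ j,
    (LinearMap.toContinuousLinearMap (b.coord j)).smulRight (Ξ (ℓ j) x)
  have hAo : A o = ContinuousLinearMap.id ℂ E := by
    ext y
    simp only [A, _root_.sum_apply, ContinuousLinearMap.smulRight_apply]
    simp only [hℓ]
    simp [b.sum_repr y]
  have hA : ContDiffAt ℂ ω A o := by
    refine ContDiffAt.sum fun j _ => ?_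
    exact (ContinuousLinearMap.smulRightL ℂ E E
      (LinearMap.toContinuousLinearMap (b.coord j))).contDiff.contDiffAt.comp o
        (h.contDiffAt (ℓ j) h.base_mem)
  have hinv : ContDiffAt ℂ ω (fun x => ContinuousLinearMap.inverse (A x)) o := by
    have h1 := contDiffAt_map_inverse (𝕜 := ℂ) (n := ω) (ContinuousLinearEquiv.refl ℂ E)
    exact ContDiffAt.comp (g := ContinuousLinearMap.inverse) o (by rw [hAo]; exact h1) hA
  have hc : ContDiffAt ℂ ω (fun x => ContinuousLinearMap.inverse (A x) (Ξ ξ x)) o :=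
    hinv.clm_apply (h.contDiffAt _ h.base_mem)
  refine ⟨_, ℓ, fun j x => b.coord j (ContinuousLinearMap.inverse (A x) (Ξ ξ x)), ?_, ?_, ?_⟩
  · intro j
    exact (LinearMap.toContinuousLinearMap (b.coord j)).contDiff.contDiffAt.comp o hc
  · intro j
    simp [(h.isotropy ξ).2 hξ]
  · have h1 : ∀ᶠ x in 𝓝 o, A x ∈ Set.range ((↑) : (E ≃L[ℂ] E) → E →L[ℂ] E) := by
      refine hA.continuousAt.eventually ?_
      rw [hAo]
      exact ContinuousLinearEquiv.nhds (ContinuousLinearEquiv.refl ℂ E)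
    filter_upwards [h1] with x hx
    obtain ⟨e, he⟩ := hx
    have h2 : A x (ContinuousLinearMap.inverse (A x) (Ξ ξ x)) = Ξ ξ x := by
      rw [← he]; simp
    conv_rhs => rw [← h2]
    simp [A]

/-- Through the value of an element of the holomorphic part there passes a local section of the
complex tangent spaces. -/
theorem IsAssociatedCRGerm.exists_bracketGenerated (hM : IsAssociatedCRGerm 𝔮 Z o Ξ M) {v : 𝔤}
    (hv : v ∈ holomorphicPart 𝔮) :
    ∃ W, BracketGenerated M o W ∧ Ξ ((1 : ℂ) ⊗ₜ[ℝ] v) o = W o := by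
  obtain ⟨w, hw⟩ := mem_holomorphicPart_iff.1 hv
  obtain ⟨n, ℓ, c, hc, hco, hsum⟩ := hM.model.exists_coefficients hw
  choose p r hpr using fun j => exists_eq_one_tmul_add_I_tmul (ℓ j)
  -- `a₁ + i a₂ = ∑ c j • ℓ j`. The field of `(v - a₁ x) + i (w - a₂ x)` vanishes at `x` itself,
  -- which makes the value of `v - a₁ x` complex tangent; at `o` the correction is zero.
  let a₁ : E → 𝔤 := fun x => ∑ j, ((c j x).re • p j - (c j x).im • r j)
  let a₂ : E → 𝔤 := fun x => ∑ j, ((c j x).re • r j + (c j x).im • p j)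
  have hW : ∀ x, realAction Ξ (v - a₁ x) x = realAction Ξ v x -
      ∑ j, ((c j x).re • realAction Ξ (p j) x - (c j x).im • realAction Ξ (r j) x) := by
    intro x
    simp [a₁, map_sub, map_sum, Finset.sum_apply]
  have hI : ∀ᶠ x in 𝓝 o, Complex.I • realAction Ξ (v - a₁ x) x = realAction Ξ (w - a₂ x) x := by
    filter_upwards [hsum] with x hx
    simp only [hpr, map_one_tmul_add_I_tmul, ← realAction_apply] at hx
    have h1 : realAction Ξ (a₁ x) x + Complex.I • realAction Ξ (a₂ x) x =
        realAction Ξ v x + Complex.I • realAction Ξ w x := by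
      rw [← hx]
      simp only [a₁, a₂, map_sum, map_sub, map_add, map_smul, Finset.sum_apply, Pi.sub_apply,
        Pi.add_apply, Pi.smul_apply, Finset.smul_sum, ← Finset.sum_add_distrib]
      refine Finset.sum_congr rfl fun j _ => ?_
      conv_rhs => rw [← Complex.re_add_im (c j x)]
      simp only [← Complex.coe_smul, smul_add, add_smul, smul_smul]
      rw [add_mul, mul_assoc (((c j x).im : ℝ) : ℂ), Complex.I_mul_I]
      module
    have h2 : Complex.I • (Complex.I • realAction Ξ (w - a₂ x) x) =
        -realAction Ξ (w - a₂ x) x := by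
      rw [smul_smul, Complex.I_mul_I, neg_one_smul]
    have h3 : realAction Ξ (v - a₁ x) x = -(Complex.I • realAction Ξ (w - a₂ x) x) := by
      simp only [map_sub, Pi.sub_apply, smul_sub]
      rw [← sub_eq_zero]
      have := sub_eq_zero.2 h1
      rw [← neg_eq_zero, ← this]
      abel
    rw [h3, smul_neg, h2, neg_neg]
  refine ⟨fun x => realAction Ξ (v - a₁ x) x, BracketGenerated.of _ ?_ ?_, ?_⟩
  · have hX : ∀ u : 𝔤, ∀ᶠ x in 𝓝 o, ContDiffAt ℝ ω (realAction Ξ u) x := fun u =>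
      Filter.eventually_of_mem (hM.model.isOpen.mem_nhds hM.model.base_mem) fun x hx =>
        (hM.model.contDiffAt _ hx).restrict_scalars ℝ
    have hc' : ∀ j, ∀ᶠ x in 𝓝 o, ContDiffAt ℝ ω (c j) x := fun j =>
      ((hc j).eventually (by simp)).mono fun x hx => hx.restrict_scalars ℝ
    simp only [hW]
    filter_upwards [hX v, Filter.eventually_all.2 fun j => hX (p j),
      Filter.eventually_all.2 fun j => hX (r j), Filter.eventually_all.2 hc'] with x h1 h2 h3 h4
    refine ContDiffAt.of_le (n := ω) ?_ (by simp)
    refine h1.sub (ContDiffAt.sum fun j _ => ContDiffAt.sub ?_ ?_)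
    · exact (Complex.reCLM.contDiff.contDiffAt.comp x (h4 j)).smul (h2 j)
    · exact (Complex.imCLM.contDiff.contDiffAt.comp x (h4 j)).smul (h3 j)
  · filter_upwards [hI] with x hx hxM
    refine ⟨(hM.mem_tangentSpaceAt hxM).2 ⟨_, rfl⟩, (hM.mem_tangentSpaceAt hxM).2 ⟨w - a₂ x, ?_⟩⟩
    exact hx.symm
  · simp [hW, hco, realAction_apply]

theorem IsAssociatedCRGerm.isMinimalAt (hM : IsAssociatedCRGerm 𝔮 Z o Ξ M)
    (h : LieSubalgebra.lieSpan ℝ 𝔤 (holomorphicPart 𝔮 : Set 𝔤) = ⊤) : IsMinimalAt M o := by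
  have : FiniteDimensional ℝ E := FiniteDimensional.complexToReal E
  have hZ : ∀ᶠ x in 𝓝 o, x ∈ Z := hM.model.isOpen.mem_nhds hM.model.base_mem
  have hXs : ∀ v : 𝔤, ∀ᶠ x in 𝓝 o, ContDiffAt ℝ ∞ (realAction Ξ v) x := fun v =>
    hZ.mono fun x hx => ((hM.model.contDiffAt _ hx).restrict_scalars ℝ).of_le (by simp)
  have hXc : ∀ v : 𝔤, ∀ᶠ x in 𝓝 o, DifferentiableAt ℂ (realAction Ξ v) x := fun v =>
    hZ.mono fun x hx => (hM.model.holomorphic _ x hx).differentiableAt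
  have hXt : ∀ v : 𝔤, ∀ᶠ x in 𝓝 o, x ∈ M → realAction Ξ v x ∈ tangentSpaceAt M x := fun v =>
    Filter.Eventually.of_forall fun x hx => (hM.mem_tangentSpaceAt hx).2 ⟨v, rfl⟩
  let 𝔨 : LieSubalgebra ℝ 𝔤 :=
    { carrier := {v | ∃ V, BracketGenerated M o V ∧ realAction Ξ v o = V o}
      add_mem' := by
        rintro v w ⟨V, hV, hv⟩ ⟨W, hW, hw⟩
        exact ⟨V + W, hV.add hW, by simp [hv, hw]⟩
      zero_mem' := by
        obtain ⟨V, hV, -⟩ := hM.exists_bracketGenerated (zero_mem (holomorphicPart 𝔮))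
        exact ⟨_, hV.smul 0, by simp⟩
      smul_mem' := by
        rintro c v ⟨V, hV, hv⟩
        exact ⟨c • V, hV.smul c, by simp [hv]⟩
      lie_mem' := by
        intro v w hv hw
        obtain ⟨V, hV, hVo⟩ := BracketGenerated.exists_lieBracket_eq (by simp)
          hM.leaf.isSubmanifold (hXs v) (hXc v) (hXt v) (hXs w) (hXc w) (hXt w) hv hw
        exact ⟨V, hV, by rw [hM.realAction_lie v w hM.model.base_mem, hVo]⟩ }
  have hle : LieSubalgebra.lieSpan ℝ 𝔤 (holomorphicPart 𝔮 : Set 𝔤) ≤ 𝔨 :=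
    LieSubalgebra.lieSpan_le.2 fun v hv => hM.exists_bracketGenerated hv
  intro Y hYM hY hoY hHY
  refine le_antisymm (tangentSpaceAt_mono hYM o) fun y hy => ?_
  obtain ⟨v, rfl⟩ := (hM.mem_tangentSpaceAt hM.leaf.base_mem).1 hy
  rw [h] at hle
  obtain ⟨V, hV, hVo⟩ := hle (LieSubalgebra.mem_top v)
  rw [← realAction_apply, hVo]
  exact (hV.eventually_mem_tangentSpaceAt two_le_infty hY hYM hHY).self_of_nhds hoY

end Sections

/-! ### Uniqueness for linear differential inequalities. -/

section Gronwall

open Set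

variable {G : Type*} [NormedAddCommGroup G] [NormedSpace ℝ G]

theorem hasDerivWithinAt_Ici_of_Icc {f : ℝ → G} {f' : G} {a b t : ℝ}
    (h : HasDerivWithinAt f f' (Icc a b) t) (ht : t ∈ Ico a b) : HasDerivWithinAt f f' (Ici t) t :=
  h.mono_of_mem_nhdsWithin (Icc_mem_nhdsGE_of_mem ht)

theorem eq_zero_of_norm_deriv_le {f f' : ℝ → G} {C : ℝ}
    (hf : ∀ t ∈ Icc (0 : ℝ) 1, HasDerivWithinAt f (f' t) (Icc 0 1) t)
    (hC : ∀ t ∈ Icc (0 : ℝ) 1, ‖f' t‖ ≤ C * ‖f t‖) (h0 : f 0 = 0) :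
    ∀ t ∈ Icc (0 : ℝ) 1, f t = 0 :=
  eq_zero_of_abs_deriv_le_mul_abs_self_of_eq_zero_right
    (fun t ht => (hf t ht).continuousWithinAt)
    (fun t ht => hasDerivWithinAt_Ici_of_Icc (hf t (Ico_subset_Icc_self ht)) ht) h0
    (fun t ht => hC t (Ico_subset_Icc_self ht))

theorem eq_zero_left_of_norm_deriv_le {f f' : ℝ → G} {C : ℝ}
    (hf : ∀ t ∈ Icc (0 : ℝ) 1, HasDerivWithinAt f (f' t) (Icc 0 1) t)
    (hC : ∀ t ∈ Icc (0 : ℝ) 1, ‖f' t‖ ≤ C * ‖f t‖) (h1 : f 1 = 0) : f 0 = 0 := by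
  have hm : MapsTo (fun t : ℝ => 1 - t) (Icc 0 1) (Icc 0 1) := fun t ht =>
    ⟨by linarith [ht.2], by linarith [ht.1]⟩
  have h := eq_zero_of_norm_deriv_le (f := fun t => f (1 - t)) (f' := fun t => -f' (1 - t)) (C := C)
    (fun t ht => by
      have h2 : HasDerivWithinAt (fun t : ℝ => 1 - t) (-1) (Icc 0 1) t := by
        simpa using (hasDerivWithinAt_id t (Icc (0 : ℝ) 1)).const_sub 1
      simpa using! (hf (1 - t) (hm ht)).scomp t h2 hm)
    (fun t ht => by simpa using hC (1 - t) (hm ht)) (by simpa using h1) 1 (by simp)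
  simpa using h

end Gronwall

/-! ### Trajectories, the variational equation and uniform bounds. -/

section Trajectories

open Set

variable {E : Type*} [NormedAddCommGroup E] [NormedSpace ℝ E]
  {V : Type*} [NormedAddCommGroup V] [NormedSpace ℝ V]

/-- `γ` is an integral curve on `[0, 1]` of the vector field `x ↦ A x u`. -/
def IsTrajectory (A : E → V →L[ℝ] E) (u : V) (γ : ℝ → E) : Prop :=
  ∀ t ∈ Icc (0 : ℝ) 1, HasDerivWithinAt γ (A (γ t) u) (Icc 0 1) t

theorem IsTrajectory.continuousOn {A : E → V →L[ℝ] E} {u : V} {γ : ℝ → E}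
    (h : IsTrajectory A u γ) : ContinuousOn γ (Icc 0 1) :=
  fun t ht => (h t ht).continuousWithinAt

/-- The vector fields `x ↦ A x v` satisfy the bracket relations of `β` at `x`. -/
def BracketRelationAt (A : E → V →L[ℝ] E) (β : V →L[ℝ] V →L[ℝ] V) (x : E) : Prop :=
  ∀ v w, A x (β v w) = fderiv ℝ A x (A x v) w - fderiv ℝ A x (A x w) v

/-- The derivative of the field of `v t` along an integral curve of the field of `u`. -/
theorem IsTrajectory.hasDerivWithinAt_apply {A : E → V →L[ℝ] E} {β : V →L[ℝ] V →L[ℝ] V} {u : V}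
    {γ : ℝ → E} (hγ : IsTrajectory A u γ) {t : ℝ} (ht : t ∈ Icc (0 : ℝ) 1)
    (hA : DifferentiableAt ℝ A (γ t)) (hβ : BracketRelationAt A β (γ t)) {v : ℝ → V} {w : V}
    (hv : HasDerivAt v (w + β (v t) u) t) :
    HasDerivWithinAt (fun s => A (γ s) (v s))
      (A (γ t) w + fderiv ℝ A (γ t) (A (γ t) (v t)) u) (Icc 0 1) t := by
  have h1 := (hA.hasFDerivAt.comp_hasDerivWithinAt t (hγ t ht)).clm_apply hv.hasDerivWithinAt
  refine h1.congr_deriv ?_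
  simp only [Function.comp_apply]
  -- The bracket relation trades the derivative of `A` along the curve for its derivative along `A
  -- (γ t) (v t)`; what remains is the variational equation of the flow.
  rw [map_add, hβ]
  abel

/-- Uniform second order estimates for a family of vector fields. -/
structure HasQuadraticBound (A : E → V →L[ℝ] E) (s : Set E) (C : ℝ) : Prop where
  pos : 0 < C
  differentiableAt : ∀ x ∈ s, DifferentiableAt ℝ A x
  norm_le : ∀ x ∈ s, ‖A x‖ ≤ C
  norm_fderiv_le : ∀ x ∈ s, ‖fderiv ℝ A x‖ ≤ C
  norm_sub_le : ∀ x ∈ s, ∀ y ∈ s, ‖A y - A x‖ ≤ C * ‖y - x‖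
  norm_sub_sub_le : ∀ x ∈ s, ∀ y ∈ s, ‖A y - A x - fderiv ℝ A x (y - x)‖ ≤ C * ‖y - x‖ ^ 2

theorem HasQuadraticBound.mono {A : E → V →L[ℝ] E} {s t : Set E} {C : ℝ}
    (h : HasQuadraticBound A s C) (hts : t ⊆ s) : HasQuadraticBound A t C where
  pos := h.pos
  differentiableAt x hx := h.differentiableAt x (hts hx)
  norm_le x hx := h.norm_le x (hts hx)
  norm_fderiv_le x hx := h.norm_fderiv_le x (hts hx)
  norm_sub_le x hx y hy := h.norm_sub_le x (hts hx) y (hts hy)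
  norm_sub_sub_le x hx y hy := h.norm_sub_sub_le x (hts hx) y (hts hy)

/-- The derivative of a `C²` map is locally Lipschitz, and the mean value inequality on segments
gives the quadratic remainder. The constant is a sum so as to dominate all the bounds at once. -/
theorem exists_hasQuadraticBound {A : E → V →L[ℝ] E} {o : E} (hA : ContDiffAt ℝ 2 A o) {U : Set E}
    (hU : U ∈ 𝓝 o) : ∃ R > 0, ∃ C, Metric.closedBall o R ⊆ U ∧
      HasQuadraticBound A (Metric.closedBall o R) C := by
  have hA1 : ContDiffAt ℝ 1 (fderiv ℝ A) o := hA.fderiv_right (by norm_num)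
  obtain ⟨K, s, hs, hK⟩ := (hA.of_le (by norm_num)).exists_lipschitzOnWith
  obtain ⟨K', s', hs', hK'⟩ := hA1.exists_lipschitzOnWith
  have h1 : ∀ᶠ x in 𝓝 o, ‖A x‖ < ‖A o‖ + 1 :=
    hA.continuousAt.norm.eventually_lt_const (lt_add_one _)
  have h2 : ∀ᶠ x in 𝓝 o, ‖fderiv ℝ A x‖ < ‖fderiv ℝ A o‖ + 1 :=
    (ContinuousAt.norm (E := E →L[ℝ] V →L[ℝ] E) (f := fderiv ℝ A)
      hA1.continuousAt).eventually_lt_const (lt_add_one _)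
  have h3 : ∀ᶠ x in 𝓝 o, DifferentiableAt ℝ A x :=
    (hA.eventually (by simp)).mono fun x hx => hx.differentiableAt (by simp)
  obtain ⟨R, hR, hball⟩ := Metric.nhds_basis_closedBall.eventually_iff.1
    (h1.and (h2.and (h3.and (Filter.Eventually.and hs (Filter.Eventually.and hs' hU)))))
  refine ⟨R, hR, ‖A o‖ + 1 + (‖fderiv ℝ A o‖ + 1) + K + K',
    fun x hx => (hball hx).2.2.2.2.2, by positivity, fun x hx => (hball hx).2.2.1,
    fun x hx => ?_, fun x hx => ?_, fun x hx y hy => ?_, fun x hx y hy => ?_⟩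
  · have := (hball hx).1
    linarith [norm_nonneg (fderiv ℝ A o), K.2, K'.2]
  · have := (hball hx).2.1
    linarith [norm_nonneg (A o), K.2, K'.2]
  · refine (hK.norm_sub_le (hball hy).2.2.2.1 (hball hx).2.2.2.1).trans ?_
    gcongr
    linarith [norm_nonneg (fderiv ℝ A o), norm_nonneg (A o), K.2, K'.2]
  · have hseg : segment ℝ x y ⊆ Metric.closedBall o R :=
      (convex_closedBall o R).segment_subset hx hy
    have h4 := (convex_segment x y).norm_image_sub_le_of_norm_fderiv_le' (𝕜 := ℝ) (f := A)
      (φ := fderiv ℝ A x) (C := K' * ‖y - x‖) (fun z hz => (hball (hseg hz)).2.2.1)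
      (fun z hz => (hK'.norm_sub_le (hball (hseg hz)).2.2.2.2.1 (hball hx).2.2.2.2.1).trans (by
        gcongr; exact norm_sub_le_of_mem_segment hz))
      (left_mem_segment ℝ x y) (right_mem_segment ℝ x y)
    refine h4.trans ?_
    rw [mul_assoc, ← sq]
    gcongr
    linarith [norm_nonneg (fderiv ℝ A o), norm_nonneg (A o), K.2, K'.2]

theorem HasQuadraticBound.lipschitzOnWith {A : E → V →L[ℝ] E} {s : Set E} {C : ℝ}
    (h : HasQuadraticBound A s C) (u : V) :
    LipschitzOnWith (Real.toNNReal (C * ‖u‖)) (fun x => A x u) s := by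
  refine LipschitzOnWith.of_dist_le_mul fun x hx y hy => ?_
  rw [Real.coe_toNNReal _ (mul_nonneg h.pos.le (norm_nonneg u)), dist_eq_norm, dist_eq_norm,
    ← _root_.sub_apply]
  refine ((A x - A y).le_opNorm u).trans ?_
  have := h.norm_sub_le y hy x hx
  calc ‖A x - A y‖ * ‖u‖ ≤ C * ‖x - y‖ * ‖u‖ := by gcongr
    _ = C * ‖u‖ * ‖x - y‖ := by ring

/-- Small elements have trajectories over the whole of `[0, 1]`. -/
theorem HasQuadraticBound.exists_isTrajectory [CompleteSpace E] {A : E → V →L[ℝ] E} {o : E}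
    {R C : ℝ} (hR : 0 ≤ R) (h : HasQuadraticBound A (Metric.closedBall o R) C) {u : V}
    (hu : C * ‖u‖ ≤ R) :
    ∃ γ, γ 0 = o ∧ IsTrajectory A u γ ∧ ∀ t, γ t ∈ Metric.closedBall o R := by
  -- The speed is at most `C * ‖u‖ ≤ R`, so the ball cannot be left in unit time.
  have hPL : IsPicardLindelof (fun _ x => A x u) (tmin := 0) (tmax := 1) ⟨0, by simp⟩ o
      (Real.toNNReal R) 0 (Real.toNNReal (C * ‖u‖)) (Real.toNNReal (C * ‖u‖)) := by
    have h0 : 0 ≤ C * ‖u‖ := mul_nonneg h.pos.le (norm_nonneg u)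
    refine IsPicardLindelof.of_time_independent ?_ ?_ ?_
    · intro x hx
      rw [Real.coe_toNNReal _ hR] at hx
      rw [Real.coe_toNNReal _ h0]
      exact ((A x).le_opNorm u).trans (by gcongr; exact h.norm_le x hx)
    · rw [Real.coe_toNNReal _ hR]
      exact h.lipschitzOnWith u
    · rw [Real.coe_toNNReal _ hR, Real.coe_toNNReal _ h0]
      simpa using hu
  obtain ⟨α, hα⟩ := ODE.FunSpace.exists_isFixedPt_next hPL (Metric.mem_closedBall_self le_rfl)
  have hmem : ∀ t, α.compProj t ∈ Metric.closedBall o R := fun t => by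
    simpa [Real.coe_toNNReal _ hR] using α.compProj_mem_closedBall hPL.mul_max_le (t := t)
  refine ⟨α.compProj, ?_, fun t ht => ?_, hmem⟩
  · have := ODE.FunSpace.compProj_val (α := α) (t := ⟨0, by simp⟩)
    rw [this, ← hα, ODE.FunSpace.next_apply₀]
  · refine (ODE.hasDerivWithinAt_picard_Icc (f := fun _ x => A x u) (t₀ := 0) (by simp)
      hPL.continuousOn_uncurry α.continuous_compProj.continuousOn
      (fun _ _ => α.compProj_mem_closedBall hPL.mul_max_le) o ht).congr_of_mem ?_ ht
    intro t' ht'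
    nth_rw 1 [← hα]
    rw [ODE.FunSpace.compProj_of_mem ht', ODE.FunSpace.next_apply]

end Trajectories

/-! ### Exponentials and the derivative of the exponential map. -/

section Exponential

variable {V : Type*} [NormedAddCommGroup V] [NormedSpace ℝ V]

/-- The generator of the inhomogeneous linear equation `b' = w + β b u`, on pairs `(b, w)`. -/
noncomputable def inhomogeneousGenerator (β : V →L[ℝ] V →L[ℝ] V) (u : V) : V × V →L[ℝ] V × V :=
  (ContinuousLinearMap.inl ℝ V V).comp
    ((β.flip u).comp (ContinuousLinearMap.fst ℝ V V) + ContinuousLinearMap.snd ℝ V V)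

/-- `inhomogeneousSolution β t u w` is the solution `b` at time `t` of `b' = w + β b u`,
`b 0 = 0`. -/
noncomputable def inhomogeneousSolution (β : V →L[ℝ] V →L[ℝ] V) (t : ℝ) (u : V) : V →L[ℝ] V :=
  (ContinuousLinearMap.fst ℝ V V).comp
    ((NormedSpace.exp (t • inhomogeneousGenerator β u)).comp (ContinuousLinearMap.inr ℝ V V))

theorem inhomogeneousSolution_zero (β : V →L[ℝ] V →L[ℝ] V) (u w : V) :
    inhomogeneousSolution β 0 u w = 0 := by
  simp [inhomogeneousSolution]

variable [CompleteSpace V]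

theorem hasDerivAt_exp_smul_apply (B : V →L[ℝ] V) (v : V) (t : ℝ) :
    HasDerivAt (fun s : ℝ => NormedSpace.exp (s • B) v) (B (NormedSpace.exp (t • B) v)) t := by
  have h := (hasDerivAt_exp_smul_const' (𝕂 := ℝ) B t).clm_apply (hasDerivAt_const t v)
  simpa using h

theorem exp_apply_mem {S : Submodule ℝ V} (hS : IsClosed (S : Set V)) {B : V →L[ℝ] V}
    (hB : ∀ v ∈ S, B v ∈ S) {v : V} (hv : v ∈ S) : NormedSpace.exp B v ∈ S := by
  have h1 := NormedSpace.exp_series_hasSum_exp' (𝕂 := ℝ) B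
  have h2 := h1.mapL (ContinuousLinearMap.apply ℝ V v)
  refine hS.mem_of_tendsto h2 (Filter.Eventually.of_forall fun s => ?_)
  refine S.sum_mem fun n _ => ?_
  have h3 : (B ^ n) v ∈ S := by
    clear * - hB hv
    induction n with
    | zero => simpa using hv
    | succ n ih => rw [pow_succ']; exact hB _ ih
  simpa using S.smul_mem _ h3

theorem exp_neg_apply_exp_apply (B : V →L[ℝ] V) (v : V) :
    NormedSpace.exp (-B) (NormedSpace.exp B v) = v := by
  let : NormedAlgebra ℚ (V →L[ℝ] V) := NormedAlgebra.restrictScalars ℚ ℝ _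
  rw [← mul_apply_eq_comp,
    ← NormedSpace.exp_add_of_commute (Commute.neg_left (Commute.refl B))]
  simp

variable (β : V →L[ℝ] V →L[ℝ] V)

/-- On the doubled space the equation becomes homogeneous, with second component constantly `w`. At
`t = 1` the solution is `∫₀¹ exp (s B) w ds` with `B = β.flip u`, the factor in the derivative of
the exponential map. -/
theorem hasDerivAt_inhomogeneousSolution (u w : V) (t : ℝ) :
    HasDerivAt (fun s => inhomogeneousSolution β s u w)
      (w + β (inhomogeneousSolution β t u w) u) t := by
  have h := fun s => hasDerivAt_exp_smul_apply (inhomogeneousGenerator β u) ((0 : V), w) s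
  have h2 : ∀ s : ℝ, (NormedSpace.exp (s • inhomogeneousGenerator β u) ((0 : V), w)).2 = w := by
    intro s
    have h3 : ∀ s, HasDerivAt
        (fun s : ℝ => (NormedSpace.exp (s • inhomogeneousGenerator β u) ((0 : V), w)).2) 0 s := by
      intro s
      have := (ContinuousLinearMap.snd ℝ V V).hasFDerivAt.comp_hasDerivAt s (h s)
      simpa [inhomogeneousGenerator] using! this
    have h4 := is_const_of_deriv_eq_zero (fun s => (h3 s).differentiableAt)
      (fun s => (h3 s).deriv) s 0
    simpa using h4
  have h5 := (ContinuousLinearMap.fst ℝ V V).hasFDerivAt.comp_hasDerivAt t (h t)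
  have h6 : ∀ p : V × V, (inhomogeneousGenerator β u p).1 = p.2 + β p.1 u := fun p => by
    simp [inhomogeneousGenerator, add_comm]
  refine h5.congr_deriv ?_
  rw [ContinuousLinearMap.coe_fst', h6, h2]
  rfl

theorem inhomogeneousSolution_at_zero (t : ℝ) (w : V) :
    inhomogeneousSolution β t 0 w = t • w := by
  have h : ∀ s, HasDerivAt (fun s => inhomogeneousSolution β s 0 w - s • w) 0 s := by
    intro s
    have := (hasDerivAt_inhomogeneousSolution β 0 w s).sub ((hasDerivAt_id s).smul_const w)
    simpa using! this
  have h4 := is_const_of_deriv_eq_zero (fun s => (h s).differentiableAt)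
      (fun s => (h s).deriv) t 0
  simpa [inhomogeneousSolution_zero, sub_eq_zero] using h4

theorem contDiff_inhomogeneousSolution {n : WithTop ℕ∞} (t : ℝ) :
    ContDiff ℝ n (inhomogeneousSolution β t) := by
  have h1 : ContDiff ℝ n (inhomogeneousGenerator β) := by
    unfold inhomogeneousGenerator
    exact contDiff_const.clm_comp ((β.flip.contDiff.clm_comp contDiff_const).add contDiff_const)
  have h2 : ContDiff ℝ n (NormedSpace.exp : (V × V →L[ℝ] V × V) → _) :=
    contDiff_iff_contDiffAt.2 fun x => (NormedSpace.exp_analytic (𝕂 := ℝ) x).contDiffAt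
  unfold inhomogeneousSolution
  exact contDiff_const.clm_comp ((h2.comp (h1.const_smul t)).clm_comp contDiff_const)

theorem exists_norm_inhomogeneousSolution_le (u : V) :
    ∃ K, ∀ t ∈ Set.Icc (0 : ℝ) 1, ‖inhomogeneousSolution β t u‖ ≤ K := by
  have h1 : Continuous fun t : ℝ => NormedSpace.exp (t • inhomogeneousGenerator β u) :=
    continuous_iff_continuousAt.2 fun t =>
      (hasDerivAt_exp_smul_const' (𝕂 := ℝ) (inhomogeneousGenerator β u) t).continuousAt
  have h2 : Continuous fun t : ℝ => inhomogeneousSolution β t u :=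
    continuous_const.clm_comp (h1.clm_comp continuous_const)
  exact isCompact_Icc.exists_bound_of_continuousOn h2.continuousOn

end Exponential

/-! ### Differentiability of the endpoint map and transport of isotropy. -/

section Endpoint

open Set

variable {E : Type*} [NormedAddCommGroup E] [NormedSpace ℝ E]
  {V : Type*} [NormedAddCommGroup V] [NormedSpace ℝ V]
  {A : E → V →L[ℝ] E} {β : V →L[ℝ] V →L[ℝ] V} {o : E} {R C δ : ℝ} {Γ : V → ℝ → E}

/-- Bootstrap: the derivative is built from `A ∘ ψ` and the smooth `Θ`, so it is as smooth as `ψ`,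
and `ψ` gains one order. -/
theorem contDiffOn_of_hasFDerivAt_comp {W : Type*} [NormedAddCommGroup W] [NormedSpace ℝ W]
    {Z : Set E} (hA : ContDiffOn ℝ ∞ A Z) {s : Set W} (hs : IsOpen s)
    {Θ : W → W →L[ℝ] V} (hΘ : ContDiff ℝ ∞ Θ) {ψ : W → E} (hψZ : MapsTo ψ s Z)
    (hψ : ∀ u ∈ s, HasFDerivAt ψ ((A (ψ u)).comp (Θ u)) u) : ContDiffOn ℝ ∞ ψ s := by
  rw [contDiffOn_infty]
  intro n
  induction n with
  | zero =>
    exact contDiffOn_zero.2 fun u hu => (hψ u hu).continuousAt.continuousWithinAt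
  | succ n ih =>
    push_cast
    rw [contDiffOn_succ_iff_fderiv_of_isOpen hs]
    refine ⟨fun u hu => (hψ u hu).differentiableAt.differentiableWithinAt, by simp, ?_⟩
    have hn : ((n : ℕ∞) : WithTop ℕ∞) ≤ ∞ := WithTop.coe_le_coe.2 le_top
    refine ContDiffOn.congr ?_ fun u hu => (hψ u hu).fderiv
    exact ((hA.of_le hn).comp ih hψZ).clm_comp (hΘ.of_le hn).contDiffOn

variable [CompleteSpace V]

/-- First order expansion, with quadratic error, of the endpoint of the trajectory of `u`. -/
theorem norm_endpoint_sub_le (hb : HasQuadraticBound A (Metric.closedBall o R) C)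
    (hβ : ∀ x ∈ Metric.closedBall o R, BracketRelationAt A β x) (hδ : 0 < δ)
    (hΓ : ∀ u ∈ Metric.ball (0 : V) δ, Γ u 0 = o ∧ IsTrajectory A u (Γ u) ∧
      ∀ t, Γ u t ∈ Metric.closedBall o (R / 2)) {u w : V} (hu : u ∈ Metric.ball (0 : V) δ)
    (huw : u + w ∈ Metric.ball (0 : V) δ) {K : ℝ}
    (hK : ∀ t ∈ Icc (0 : ℝ) 1, ‖inhomogeneousSolution β t u‖ ≤ K) (hw : C * (K * ‖w‖) ≤ R / 2) :
    ‖Γ (u + w) 1 - Γ u 1 - A (Γ u 1) (inhomogeneousSolution β 1 u w)‖ ≤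
      (C * (C * K) ^ 2 * ‖u‖ + C * (C * K)) / (C * δ) * (Real.exp (C * δ) - 1) * ‖w‖ ^ 2 := by
  have hC := hb.pos
  have hR : 0 ≤ R / 2 := by
    have := (hΓ u hu).2.2 0
    exact dist_nonneg.trans (Metric.mem_closedBall.1 this)
  have hsub : Metric.closedBall o (R / 2) ⊆ Metric.closedBall o R :=
    Metric.closedBall_subset_closedBall (by linarith)
  have hK0 : 0 ≤ K := (norm_nonneg _).trans (hK 0 (by simp))
  obtain ⟨h0, hγ, hm⟩ := hΓ u hu
  obtain ⟨h0', hγ', hm'⟩ := hΓ (u + w) huw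
  set γ := Γ u
  set γ' := Γ (u + w)
  -- `J` solves the variational equation along `γ` in direction `w`, so `γ + J` is a trajectory of
  -- `u + w` up to an error of order `‖w‖ ^ 2`; Gronwall compares it with `γ'`.
  set J : ℝ → E := fun t => A (γ t) (inhomogeneousSolution β t u w) with hJ
  have hJd : ∀ t ∈ Icc (0 : ℝ) 1, HasDerivWithinAt J
      (A (γ t) w + fderiv ℝ A (γ t) (J t) u) (Icc 0 1) t := fun t ht =>
    hγ.hasDerivWithinAt_apply ht (hb.differentiableAt _ (hsub (hm t))) (hβ _ (hsub (hm t)))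
      (hasDerivAt_inhomogeneousSolution β u w t)
  have hJn : ∀ t ∈ Icc (0 : ℝ) 1, ‖J t‖ ≤ C * (K * ‖w‖) := fun t ht => by
    refine ((A (γ t)).le_opNorm _).trans ?_
    gcongr
    · exact hb.norm_le _ (hsub (hm t))
    · exact (ContinuousLinearMap.le_opNorm _ _).trans (by gcongr; exact hK t ht)
  -- The trajectories use only half the radius, which leaves room for `J`.
  have hη : ∀ t ∈ Icc (0 : ℝ) 1, γ t + J t ∈ Metric.closedBall o R := fun t ht => by
    have h1 := hm t
    rw [mem_closedBall_iff_norm] at h1 ⊢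
    calc ‖γ t + J t - o‖ = ‖(γ t - o) + J t‖ := by congr 1; abel
      _ ≤ ‖γ t - o‖ + ‖J t‖ := norm_add_le _ _
      _ ≤ R := by linarith [hJn t ht]
  have hηd : ∀ t ∈ Icc (0 : ℝ) 1, HasDerivWithinAt (fun s => γ s + J s)
      (A (γ t) u + (A (γ t) w + fderiv ℝ A (γ t) (J t) u)) (Icc 0 1) t := fun t ht =>
    (hγ t ht).add (hJd t ht)
  have hη_err : ∀ t ∈ Icc (0 : ℝ) 1, dist (A (γ t) u + (A (γ t) w + fderiv ℝ A (γ t) (J t) u))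
      (A (γ t + J t) (u + w)) ≤ (C * (C * K) ^ 2 * ‖u‖ + C * (C * K)) * ‖w‖ ^ 2 := fun t ht => by
    have h1 := hb.norm_sub_sub_le _ (hsub (hm t)) _ (hη t ht)
    have h2 := hb.norm_sub_le _ (hsub (hm t)) _ (hη t ht)
    simp only [add_sub_cancel_left] at h1 h2
    rw [dist_comm, dist_eq_norm]
    calc ‖A (γ t + J t) (u + w) - (A (γ t) u + (A (γ t) w + fderiv ℝ A (γ t) (J t) u))‖
        = ‖(A (γ t + J t) - A (γ t) - fderiv ℝ A (γ t) (J t)) u +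
            (A (γ t + J t) - A (γ t)) w‖ := by
          congr 1
          simp only [map_add, _root_.sub_apply]
          abel
      _ ≤ C * ‖J t‖ ^ 2 * ‖u‖ + C * ‖J t‖ * ‖w‖ := by
          refine (norm_add_le _ _).trans (add_le_add ?_ ?_)
          · exact (ContinuousLinearMap.le_opNorm _ _).trans (by gcongr)
          · exact (ContinuousLinearMap.le_opNorm _ _).trans (by gcongr)
      _ ≤ C * (C * (K * ‖w‖)) ^ 2 * ‖u‖ + C * (C * (K * ‖w‖)) * ‖w‖ := by
          gcongr
          · exact hJn t ht
          · exact hJn t ht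
      _ = _ := by ring
  have hcδ : 0 < C * δ := mul_pos hC hδ
  -- `C * δ` replaces `C * ‖u + w‖`: it is positive and independent of `w`, so Gronwall's closed
  -- formula applies with a uniform constant.
  have hlip : LipschitzOnWith (Real.toNNReal (C * δ)) (fun x => A x (u + w))
      (Metric.closedBall o R) := by
    refine (hb.lipschitzOnWith (u + w)).weaken (Real.toNNReal_le_toNNReal ?_)
    gcongr
    exact (mem_ball_zero_iff.1 huw).le
  have key := dist_le_of_approx_trajectories_ODE_of_mem (v := fun _ x => A x (u + w))
    (s := fun _ => Metric.closedBall o R) (K := Real.toNNReal (C * δ)) (a := 0) (b := 1)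
    (f := γ') (f' := fun t => A (γ' t) (u + w)) (εf := 0)
    (g := fun t => γ t + J t)
    (g' := fun t => A (γ t) u + (A (γ t) w + fderiv ℝ A (γ t) (J t) u)) (δ := 0)
    (fun _ _ => hlip) hγ'.continuousOn
    (fun t ht => hasDerivWithinAt_Ici_of_Icc (hγ' t (Ico_subset_Icc_self ht)) ht)
    (fun t _ => by simp) (fun t _ => hsub (hm' t))
    (fun t ht => (hηd t ht).continuousWithinAt)
    (fun t ht => hasDerivWithinAt_Ici_of_Icc (hηd t (Ico_subset_Icc_self ht)) ht)
    (fun t ht => hη_err t (Ico_subset_Icc_self ht)) (fun t ht => hη t (Ico_subset_Icc_self ht))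
    (by simp [hJ, h0, h0', inhomogeneousSolution_zero]) 1 (by simp)
  rw [dist_eq_norm, Real.coe_toNNReal _ hcδ.le, gronwallBound_of_K_ne_0 hcδ.ne'] at key
  rw [sub_sub]
  refine key.trans (le_of_eq ?_)
  simp only [sub_zero, mul_one, zero_mul, zero_add]
  ring

theorem hasFDerivAt_endpoint (hR : 0 < R) (hb : HasQuadraticBound A (Metric.closedBall o R) C)
    (hβ : ∀ x ∈ Metric.closedBall o R, BracketRelationAt A β x)
    (hΓ : ∀ u ∈ Metric.ball (0 : V) δ, Γ u 0 = o ∧ IsTrajectory A u (Γ u) ∧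
      ∀ t, Γ u t ∈ Metric.closedBall o (R / 2)) {u : V} (hu : u ∈ Metric.ball (0 : V) δ) :
    HasFDerivAt (fun u => Γ u 1) ((A (Γ u 1)).comp (inhomogeneousSolution β 1 u)) u := by
  have hδ : 0 < δ := Metric.pos_of_mem_ball hu
  obtain ⟨K, hK⟩ := exists_norm_inhomogeneousSolution_le β u
  rw [hasFDerivAt_iff_isLittleO_nhds_zero]
  refine Asymptotics.IsBigO.trans_isLittleO (g := fun w : V => ‖w‖ ^ 2) ?_
    (Asymptotics.isLittleO_norm_pow_id one_lt_two)
  have h1 : ∀ᶠ w in 𝓝 (0 : V), u + w ∈ Metric.ball (0 : V) δ := by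
    have : Filter.Tendsto (fun w => u + w) (𝓝 0) (𝓝 u) := by
      simpa using (by fun_prop : Continuous fun w : V => u + w).tendsto 0
    exact this.eventually (Metric.isOpen_ball.mem_nhds hu)
  have h2 : ∀ᶠ w in 𝓝 (0 : V), C * (K * ‖w‖) < R / 2 := by
    have : Filter.Tendsto (fun w : V => C * (K * ‖w‖)) (𝓝 0) (𝓝 0) := by
      simpa using (by fun_prop : Continuous fun w : V => C * (K * ‖w‖)).tendsto 0
    exact this.eventually_lt_const (by linarith)
  refine Asymptotics.IsBigO.of_bound
    ((C * (C * K) ^ 2 * ‖u‖ + C * (C * K)) / (C * δ) * (Real.exp (C * δ) - 1)) ?_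
  filter_upwards [h1, h2] with w h3 h4
  simpa using norm_endpoint_sub_le hb hβ hδ hΓ hu h3 hK h4.le

/-- The transport along a trajectory carries isotropy to isotropy. -/
theorem IsTrajectory.apply_exp_eq_zero {s : Set E} (hb : HasQuadraticBound A s C)
    (hβ : ∀ x ∈ s, BracketRelationAt A β x) {u : V} {γ : ℝ → E} (hγ : IsTrajectory A u γ)
    (hs : ∀ t ∈ Icc (0 : ℝ) 1, γ t ∈ s) {v : V} (hv : A (γ 0) v = 0) :
    A (γ 1) (NormedSpace.exp (β.flip u) v) = 0 := by
  -- `A (γ t) (exp (t B) v)` solves the homogeneous variational equation and starts at zero.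
  have h := eq_zero_of_norm_deriv_le
    (f := fun t => A (γ t) (NormedSpace.exp (t • β.flip u) v))
    (f' := fun t => A (γ t) 0 +
      fderiv ℝ A (γ t) (A (γ t) (NormedSpace.exp (t • β.flip u) v)) u) (C := C * ‖u‖)
    (fun t ht => hγ.hasDerivWithinAt_apply ht (hb.differentiableAt _ (hs t ht)) (hβ _ (hs t ht))
      (by simpa using hasDerivAt_exp_smul_apply (β.flip u) v t))
    (fun t ht => by
      simp only [map_zero, zero_add]
      refine (ContinuousLinearMap.le_opNorm _ _).trans ?_
      calc _ ≤ (C * ‖A (γ t) (NormedSpace.exp (t • β.flip u) v)‖) * ‖u‖ := by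
            gcongr
            refine (ContinuousLinearMap.le_opNorm _ _).trans ?_
            gcongr
            exact hb.norm_fderiv_le _ (hs t ht)
        _ = _ := by ring) (by simpa using hv) 1 (by simp)
  simpa using h

/-- The invertible transport embeds the initial isotropy into the final one; rank-nullity then
bounds the rank. -/
theorem IsTrajectory.finrank_range_le [FiniteDimensional ℝ V] {s : Set E}
    (hb : HasQuadraticBound A s C) (hβ : ∀ x ∈ s, BracketRelationAt A β x) {u : V} {γ : ℝ → E}
    (hγ : IsTrajectory A u γ) (hs : ∀ t ∈ Icc (0 : ℝ) 1, γ t ∈ s) :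
    Module.finrank ℝ (LinearMap.range (A (γ 1)).toLinearMap) ≤
      Module.finrank ℝ (LinearMap.range (A (γ 0)).toLinearMap) := by
  have h1 := LinearMap.finrank_range_add_finrank_ker (A (γ 1)).toLinearMap
  have h2 := LinearMap.finrank_range_add_finrank_ker (A (γ 0)).toLinearMap
  have h3 : Module.finrank ℝ (LinearMap.ker (A (γ 0)).toLinearMap) ≤
      Module.finrank ℝ (LinearMap.ker (A (γ 1)).toLinearMap) := by
    refine LinearMap.finrank_le_finrank_of_injective
      (f := (NormedSpace.exp (β.flip u)).toLinearMap.restrict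
        (p := LinearMap.ker (A (γ 0)).toLinearMap) (q := LinearMap.ker (A (γ 1)).toLinearMap)
        fun v hv => hγ.apply_exp_eq_zero hb hβ hs hv) ?_
    intro v w hvw
    have h4 : NormedSpace.exp (-β.flip u) (NormedSpace.exp (β.flip u) v) =
        NormedSpace.exp (-β.flip u) (NormedSpace.exp (β.flip u) w) :=
      congrArg (fun z : V => NormedSpace.exp (-β.flip u) z) (congrArg Subtype.val hvw)
    rw [exp_neg_apply_exp_apply, exp_neg_apply_exp_apply] at h4
    exact Subtype.ext h4
  omega

end Endpoint

/-! ### Local images of immersions. -/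

section Immersion

open Set

variable {E : Type*} [NormedAddCommGroup E] [NormedSpace ℝ E] [FiniteDimensional ℝ E]
  {W : Type*} [NormedAddCommGroup W] [NormedSpace ℝ W] [FiniteDimensional ℝ W]

/-- The image of a small ball under an immersion is a submanifold. -/
theorem exists_isSubmanifold_image_ball {ψ : W → E} {δ : ℝ} (hδ : 0 < δ)
    (hψ : ContDiffOn ℝ ∞ ψ (Metric.ball 0 δ)) (hinj : Function.Injective (fderiv ℝ ψ 0)) :
    ∃ ρ > 0, ρ ≤ δ ∧ IsSubmanifold ∞ (ψ '' Metric.ball 0 ρ) ∧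
      tangentSpaceAt (ψ '' Metric.ball 0 ρ) (ψ 0) ≤ LinearMap.range (fderiv ℝ ψ 0).toLinearMap ∧
      ∀ c ∈ Metric.ball (0 : W) ρ, Function.Injective (fderiv ℝ ψ c) ∧
        LinearMap.range (fderiv ℝ ψ c).toLinearMap ≤
          tangentSpaceAt (ψ '' Metric.ball 0 ρ) (ψ c) := by
  set L := fderiv ℝ ψ 0 with hL
  obtain ⟨N, hN⟩ := (LinearMap.range L.toLinearMap).exists_isCompl
  let Λ₀ : (W × N) ≃ₗ[ℝ] E :=
    ((LinearEquiv.ofInjective L.toLinearMap hinj).prodCongr (LinearEquiv.refl ℝ N)).trans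
      (Submodule.prodEquivOfIsCompl _ N hN)
  let Λ : (W × N) ≃L[ℝ] E := Λ₀.toContinuousLinearEquiv
  have hΛ : ∀ p : W × N, Λ p = L p.1 + p.2 := fun p => rfl
  -- Thickening `ψ` by a complement `N` of its tangent space gives a local diffeomorphism; its
  -- inverse followed by `Λ` straightens the image.
  let Ψ : W × N → E := fun p => ψ p.1 + p.2
  have hψd : ∀ c ∈ Metric.ball (0 : W) δ, ContDiffAt ℝ ∞ ψ c := fun c hc =>
    hψ.contDiffAt (Metric.isOpen_ball.mem_nhds hc)
  have hΨ : ∀ p : W × N, p.1 ∈ Metric.ball (0 : W) δ → ContDiffAt ℝ ∞ Ψ p := fun p hp =>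
    ((hψd _ hp).comp p contDiffAt_fst).add
      (N.subtypeL.contDiff.contDiffAt.comp p contDiffAt_snd)
  have hΨ' : ∀ p : W × N, p.1 ∈ Metric.ball (0 : W) δ → HasFDerivAt Ψ
      ((fderiv ℝ ψ p.1).comp (ContinuousLinearMap.fst ℝ W N) +
        N.subtypeL.comp (ContinuousLinearMap.snd ℝ W N)) p := fun p hp =>
    (((hψd _ hp).differentiableAt (by simp)).hasFDerivAt.comp p hasFDerivAt_fst).add
      (N.subtypeL.hasFDerivAt.comp p hasFDerivAt_snd)
  have h0δ : (0 : W × N).1 ∈ Metric.ball (0 : W) δ := by simpa using hδ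
  have hΨ0 : HasFDerivAt Ψ (Λ : W × N →L[ℝ] E) 0 := by
    refine (hΨ' 0 h0δ).congr_fderiv ?_
    ext p <;> simp [hΛ, hL]
  let e := (hΨ 0 h0δ).toOpenPartialHomeomorph Ψ hΨ0 (by simp)
  have he0 : (0 : W × N) ∈ e.source :=
    (hΨ 0 h0δ).mem_toOpenPartialHomeomorph_source hΨ0 (by simp)
  have h1 : ∀ᶠ p in 𝓝 (0 : W × N),
      fderiv ℝ Ψ p ∈ Set.range ((↑) : ((W × N) ≃L[ℝ] E) → W × N →L[ℝ] E) := by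
    have hc : ContinuousAt (fderiv ℝ Ψ) 0 :=
      ((hΨ 0 h0δ).fderiv_right (m := 0) (by simp)).continuousAt
    refine hc.eventually ?_
    rw [hΨ0.fderiv]
    exact ContinuousLinearEquiv.nhds Λ
  obtain ⟨ρ₀, hρ₀, hball⟩ := Metric.nhds_basis_ball.eventually_iff.1
    (h1.and (e.open_source.mem_nhds he0))
  set ρ := min ρ₀ δ
  have hρ : 0 < ρ := lt_min hρ₀ hδ
  have hρδ : ρ ≤ δ := min_le_right _ _
  have hbl : ∀ p ∈ Metric.ball (0 : W × N) ρ, p.1 ∈ Metric.ball (0 : W) ρ := fun p hp => by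
    rw [mem_ball_zero_iff] at hp ⊢
    exact (norm_fst_le p).trans_lt hp
  have hbr : ∀ c ∈ Metric.ball (0 : W) ρ, ((c, 0) : W × N) ∈ Metric.ball (0 : W × N) ρ :=
    fun c hc => by
      rw [mem_ball_zero_iff] at hc ⊢
      simpa [Prod.norm_def] using hc
  have hb₀ : ∀ p ∈ Metric.ball (0 : W × N) ρ, p ∈ Metric.ball (0 : W × N) ρ₀ := fun p hp =>
    Metric.ball_subset_ball (min_le_left _ _) hp
  have hbδ : ∀ p ∈ Metric.ball (0 : W × N) ρ, p.1 ∈ Metric.ball (0 : W) δ := fun p hp =>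
    Metric.ball_subset_ball hρδ (hbl p hp)
  -- With source exactly a ball of the sup norm, the points `(c, 0)` in it are those with `c` in the
  -- ball of `W`, so the chart sees precisely the image of that ball.
  let e' := e.restrOpen (Metric.ball 0 ρ) Metric.isOpen_ball
  have hes : ∀ p, p ∈ e'.source ↔ p ∈ Metric.ball (0 : W × N) ρ := fun p =>
    ⟨fun hp => hp.2, fun hp => ⟨(hball (hb₀ p hp)).2, hp⟩⟩
  have heΨ : ∀ p, e' p = Ψ p := fun p => rfl
  let φ : OpenPartialHomeomorph E E := e'.symm.transHomeomorph Λ.toHomeomorph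
  have hφ : ∀ y, φ y = Λ (e'.symm y) := fun y => rfl
  have hψΨ : ∀ c, ψ c = e' (c, 0) := fun c => by simp [heΨ, Ψ]
  have hmem : ∀ c ∈ Metric.ball (0 : W) ρ, ψ c ∈ φ.source := fun c hc => by
    rw [hψΨ]
    exact e'.map_source ((hes _).2 (hbr c hc))
  have hS : ∀ y ∈ φ.source,
      y ∈ ψ '' Metric.ball 0 ρ ↔ φ y ∈ LinearMap.range L.toLinearMap := by
    intro y hy
    constructor
    · rintro ⟨c, hc, rfl⟩
      rw [hφ, hψΨ, e'.left_inv ((hes _).2 (hbr c hc)), hΛ]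
      exact ⟨c, by simp⟩
    · intro h
      rw [hφ, hΛ] at h
      have h2 : ((e'.symm y).2 : E) ∈ LinearMap.range L.toLinearMap := by
        have h3 : L (e'.symm y).1 ∈ LinearMap.range L.toLinearMap := ⟨_, rfl⟩
        simpa using Submodule.sub_mem _ h h3
      have h4 : ((e'.symm y).2 : E) = 0 :=
        Submodule.disjoint_def.1 hN.disjoint _ h2 (e'.symm y).2.2
      have h5 : e'.symm y ∈ Metric.ball (0 : W × N) ρ := (hes _).1 (e'.map_target hy)
      refine ⟨(e'.symm y).1, hbl _ h5, ?_⟩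
      have h6 : e' (e'.symm y) = y := e'.right_inv hy
      rw [heΨ] at h6
      simpa [Ψ, h4] using h6
  have hinvd : ∀ p ∈ Metric.ball (0 : W × N) ρ, ∃ T : (W × N) ≃L[ℝ] E,
      HasFDerivAt Ψ (T : W × N →L[ℝ] E) p := fun p hp => by
    obtain ⟨T, hT⟩ := (hball (hb₀ p hp)).1
    exact ⟨T, hT ▸ ((hΨ p (hbδ p hp)).differentiableAt (by simp)).hasFDerivAt⟩
  have hφc : ContDiffOn ℝ ∞ φ φ.source := by
    intro y hy
    have h5 : e'.symm y ∈ Metric.ball (0 : W × N) ρ := (hes _).1 (e'.map_target hy)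
    obtain ⟨T, hT⟩ := hinvd _ h5
    exact (Λ.contDiff.contDiffAt.comp y
      (e'.contDiffAt_symm hy hT (hΨ _ (hbδ _ h5)))).contDiffWithinAt
  have hφc' : ContDiffOn ℝ ∞ φ.symm φ.target := by
    intro z hz
    have h5 : Λ.symm z ∈ Metric.ball (0 : W × N) ρ := (hes _).1 hz
    exact ((hΨ _ (hbδ _ h5)).comp z Λ.symm.contDiff.contDiffAt).contDiffWithinAt
  refine ⟨ρ, hρ, hρδ, ?_, ?_, ?_⟩
  · rintro y ⟨c, hc, rfl⟩
    exact ⟨φ, LinearMap.range L.toLinearMap, hmem c hc, hφc, hφc', hS⟩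
  · intro v hv
    have h0 : (0 : W) ∈ Metric.ball (0 : W) ρ := by simpa using hρ
    rw [mem_tangentSpaceAt_iff (by simp) hφc hφc' hS (hmem 0 h0) ⟨0, h0, rfl⟩] at hv
    have h7 : e'.symm (ψ 0) = 0 := by
      rw [hψΨ, e'.left_inv ((hes _).2 (hbr 0 h0))]; rfl
    have h8 : HasFDerivAt e'.symm (Λ.symm : E →L[ℝ] W × N) (ψ 0) :=
      e'.hasFDerivAt_symm (hmem 0 h0) (by rw [h7]; exact hΨ0)
    have h9 : HasFDerivAt φ ((Λ : W × N →L[ℝ] E).comp (Λ.symm : E →L[ℝ] W × N)) (ψ 0) :=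
      Λ.hasFDerivAt.comp (ψ 0) h8
    rw [h9.fderiv] at hv
    simpa using hv
  · intro c hc
    have hd : HasFDerivAt ψ (fderiv ℝ ψ c) c :=
      ((hψd c (Metric.ball_subset_ball hρδ hc)).differentiableAt (by simp)).hasFDerivAt
    constructor
    · obtain ⟨T, hT⟩ := hinvd _ (hbr c hc)
      have h2 := hT.unique (hΨ' _ (hbδ _ (hbr c hc)))
      have h3 : ∀ w, fderiv ℝ ψ c w = T (w, 0) := fun w => by
        have := congrArg (fun S : W × N →L[ℝ] E => S (w, 0)) h2
        simpa using this.symm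
      intro w w' hww
      rw [h3, h3] at hww
      exact congrArg Prod.fst (T.injective hww)
    · rintro - ⟨w, rfl⟩
      have hl : HasDerivAt (fun t : ℝ => c + t • w) w 0 := by
        simpa using ((hasDerivAt_id (0 : ℝ)).smul_const w).const_add c
      refine mem_tangentSpaceAt_of_hasDerivAt (γ := fun t => ψ (c + t • w)) (by simp) ?_ ?_
      · have h2 : HasFDerivAt ψ (fderiv ℝ ψ c) (c + (0 : ℝ) • w) := by simpa using hd
        exact h2.comp_hasDerivAt (0 : ℝ) hl
      · have h3 : ∀ᶠ t in 𝓝 (0 : ℝ), c + t • w ∈ Metric.ball (0 : W) ρ :=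
          hl.continuousAt.eventually_mem
            (Metric.isOpen_ball.mem_nhds (by rwa [zero_smul, add_zero]))
        filter_upwards [h3] with t ht using ⟨_, ht, rfl⟩

end Immersion

/-! ### Invariance of submanifolds and construction of local orbits. -/

section Orbit

open Set

variable {E : Type*} [NormedAddCommGroup E] [NormedSpace ℝ E] [FiniteDimensional ℝ E]
  {V : Type*} [NormedAddCommGroup V] [NormedSpace ℝ V]

/-- Integral curves of fields tangent to a submanifold that start in it stay in it. -/
theorem IsSubmanifold.exists_forall_isTrajectory_mem {S : Set E} {k : WithTop ℕ∞} (hk : 2 ≤ k)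
    (hS : IsSubmanifold k S) {o : E} (ho : o ∈ S) {A : E → V →L[ℝ] E} (hA : ContDiffAt ℝ 1 A o)
    (hAS : ∀ x ∈ S, ∀ v, A x v ∈ tangentSpaceAt S x) :
    ∃ U ∈ 𝓝 o, ∀ u γ, IsTrajectory A u γ → γ 0 ∈ S → (∀ t ∈ Icc (0 : ℝ) 1, γ t ∈ U) →
      ∀ t ∈ Icc (0 : ℝ) 1, γ t ∈ S := by
  obtain ⟨φ, F, hoφ, hφ, hφ', hSF⟩ := hS o ho
  have hk1 : 1 ≤ k := le_trans (by norm_num) hk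
  have hk0 : k ≠ 0 := by rintro rfl; simp at hk1
  obtain ⟨N, hN⟩ := F.exists_isCompl
  let P : E →L[ℝ] E := LinearMap.toContinuousLinearMap (F.subtype ∘ₗ F.projectionOnto N hN)
  have hPmem : ∀ z, P z ∈ F := fun z => (F.projectionOnto N hN z).2
  have hPeq : ∀ z ∈ F, P z = z := fun z hz => by
    have := Submodule.projectionOnto_apply_left hN ⟨z, hz⟩
    exact congrArg Subtype.val this
  let q : E →L[ℝ] E := ContinuousLinearMap.id ℝ E - P
  have hq : ∀ z, q z = z - P z := fun z => rfl
  let B : E → V →L[ℝ] E := fun z => (fderiv ℝ φ (φ.symm z)).comp (A (φ.symm z))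
  have hφo : φ o ∈ φ.target := φ.map_source hoφ
  have hoo : φ.symm (φ o) = o := φ.left_inv hoφ
  have hsymm : ContDiffAt ℝ 1 φ.symm (φ o) :=
    (hφ'.contDiffAt (φ.open_target.mem_nhds hφo)).of_le hk1
  have hB : ContDiffAt ℝ 1 B (φ o) := by
    have h1 : ContDiffAt ℝ 1 (fderiv ℝ φ) o :=
      (hφ.contDiffAt (φ.open_source.mem_nhds hoφ)).fderiv_right
        (by simpa [one_add_one_eq_two] using hk)
    refine ContDiffAt.clm_comp ?_ ?_
    · exact ContDiffAt.comp (g := fderiv ℝ φ) (φ o) (by rwa [hoo]) hsymm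
    · exact ContDiffAt.comp (g := A) (φ o) (by rwa [hoo]) hsymm
  obtain ⟨K, s, hs, hK⟩ := hB.exists_lipschitzOnWith
  have hPo : P (φ o) = φ o := hPeq _ ((hSF o hoφ).1 ho)
  have hφc : ContinuousAt φ o := φ.continuousAt hoφ
  have hPc : ContinuousAt (fun x => P (φ x)) o := P.continuous.continuousAt.comp hφc
  refine ⟨{x | x ∈ φ.source ∧ φ x ∈ s ∧ P (φ x) ∈ s ∧ P (φ x) ∈ φ.target}, ?_, ?_⟩
  · refine Filter.Eventually.and (φ.open_source.mem_nhds hoφ)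
      (Filter.Eventually.and (hφc.eventually_mem hs)
      (Filter.Eventually.and (hPc.eventually_mem ?_) (hPc.eventually_mem ?_)))
    · rwa [hPo]
    · rw [hPo]
      exact φ.open_target.mem_nhds hφo
  · intro u γ hγ h0 hU t ht
    have hd : ∀ t ∈ Icc (0 : ℝ) 1, HasDerivWithinAt (fun s => q (φ (γ s)))
        (q (fderiv ℝ φ (γ t) (A (γ t) u))) (Icc 0 1) t := fun t ht => by
      have h1 : HasFDerivAt φ (fderiv ℝ φ (γ t)) (γ t) :=
        ((hφ.contDiffAt (φ.open_source.mem_nhds (hU t ht).1)).differentiableAt hk0).hasFDerivAt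
      exact q.hasFDerivAt.comp_hasDerivWithinAt t (h1.comp_hasDerivWithinAt t (hγ t ht))
    -- At the projected point `P (φ (γ t))` the field is tangent, so `q` kills it there. The
    -- Lipschitz bound then controls the normal velocity by the normal component itself.
    have hbound : ∀ t ∈ Icc (0 : ℝ) 1, ‖q (fderiv ℝ φ (γ t) (A (γ t) u))‖ ≤
        (‖q‖ * K * ‖u‖) * ‖q (φ (γ t))‖ := fun t ht => by
      obtain ⟨h1, h2, h3, h4⟩ := hU t ht
      have h5 : q (B (P (φ (γ t))) u) = 0 := by
        have h6 := φ.map_target h4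
        have h7 : φ.symm (P (φ (γ t))) ∈ S := by
          rw [hSF _ h6, φ.right_inv h4]
          exact hPmem _
        have h8 := (mem_tangentSpaceAt_iff hk1 hφ hφ' hSF h6 h7).1 (hAS _ h7 u)
        rw [hq, sub_eq_zero]
        exact (hPeq _ h8).symm
      have h6 : fderiv ℝ φ (γ t) (A (γ t) u) = B (φ (γ t)) u := by
        simp [B, φ.left_inv h1]
      rw [h6, ← sub_zero (q _), ← h5, ← map_sub, ← _root_.sub_apply]
      calc _ ≤ ‖q‖ * (‖B (φ (γ t)) - B (P (φ (γ t)))‖ * ‖u‖) :=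
            (q.le_opNorm _).trans (by gcongr; exact ContinuousLinearMap.le_opNorm _ _)
        _ ≤ ‖q‖ * (K * ‖φ (γ t) - P (φ (γ t))‖ * ‖u‖) := by
            gcongr
            exact hK.norm_sub_le h2 h3
        _ = _ := by rw [hq]; ring
    have h1 := eq_zero_of_norm_deriv_le hd hbound (by
      rw [hq, hPeq _ ((hSF _ (hU 0 (by simp)).1).1 h0), sub_self]) t ht
    rw [hSF _ (hU t ht).1, sub_eq_zero.1 ((hq _).symm.trans h1)]
    exact hPmem _

/-- A finite-dimensional Lie algebra of vector fields has a local orbit through each point. -/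
theorem exists_isSubmanifold_orbit [FiniteDimensional ℝ V] {A : E → V →L[ℝ] E}
    {β : V →L[ℝ] V →L[ℝ] V} {Z : Set E} (hZ : IsOpen Z) {o : E} (ho : o ∈ Z)
    (hA : ContDiffOn ℝ ∞ A Z) (hβ : ∀ x ∈ Z, BracketRelationAt A β x) {U : Set E} (hU : U ∈ 𝓝 o) :
    ∃ Y : Set E, IsSubmanifold ∞ Y ∧ o ∈ Y ∧
      tangentSpaceAt Y o ≤ LinearMap.range (A o).toLinearMap ∧
      ∀ y ∈ Y, LinearMap.range (A y).toLinearMap ≤ tangentSpaceAt Y y ∧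
        ∃ u γ, γ 0 = o ∧ γ 1 = y ∧ IsTrajectory A u γ ∧ ∀ t ∈ Icc (0 : ℝ) 1, γ t ∈ U := by
  have : CompleteSpace V := FiniteDimensional.complete ℝ V
  have : CompleteSpace E := FiniteDimensional.complete ℝ E
  obtain ⟨R, hR, C, hRU, hb⟩ := exists_hasQuadraticBound
    ((hA.contDiffAt (hZ.mem_nhds ho)).of_le two_le_infty) (Filter.inter_mem hU (hZ.mem_nhds ho))
  have hC := hb.pos
  have hsub : Metric.closedBall o (R / 2) ⊆ Metric.closedBall o R :=
    Metric.closedBall_subset_closedBall (by linarith)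
  -- Chosen so that `‖u‖ < δ` gives `C * ‖u‖ ≤ R / 2`, and trajectories exist inside the half ball.
  set δ := R / 2 / C with hδdef
  have hδ : 0 < δ := by positivity
  have hex : ∀ u : V, ∃ γ : ℝ → E, u ∈ Metric.ball (0 : V) δ → γ 0 = o ∧ IsTrajectory A u γ ∧
      ∀ t, γ t ∈ Metric.closedBall o (R / 2) := fun u => by
    by_cases hu : u ∈ Metric.ball (0 : V) δ
    · have h1 : C * ‖u‖ ≤ R / 2 := by
        have := (mem_ball_zero_iff.1 hu).le
        rwa [hδdef, le_div_iff₀ hC, mul_comm] at this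
      obtain ⟨γ, hγ⟩ := (hb.mono hsub).exists_isTrajectory (by linarith) h1
      exact ⟨γ, fun _ => hγ⟩
    · exact ⟨fun _ => 0, fun h => absurd h hu⟩
  choose Γ hΓ using hex
  have hβR : ∀ x ∈ Metric.closedBall o R, BracketRelationAt A β x := fun x hx => hβ x (hRU hx).2
  -- Removing the isotropy directions makes the endpoint map immersive at `0`, with `dim W` the rank
  -- of `A o`.
  obtain ⟨W, hW⟩ := (LinearMap.ker (A o).toLinearMap).exists_isCompl
  let ψ : W → E := fun c => Γ c 1
  have hmemW : ∀ c ∈ Metric.ball (0 : W) δ, (c : V) ∈ Metric.ball (0 : V) δ := fun c hc => by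
    rw [mem_ball_zero_iff] at hc ⊢
    exact hc
  have hψd : ∀ c ∈ Metric.ball (0 : W) δ, HasFDerivAt ψ
      ((A (ψ c)).comp ((inhomogeneousSolution β 1 c).comp W.subtypeL)) c := fun c hc =>
    (hasFDerivAt_endpoint hR hb hβR hΓ (hmemW c hc)).comp c W.subtypeL.hasFDerivAt
  have hψc : ContDiffOn ℝ ∞ ψ (Metric.ball 0 δ) :=
    contDiffOn_of_hasFDerivAt_comp hA Metric.isOpen_ball
      (Θ := fun c : W => (inhomogeneousSolution β 1 (c : V)).comp W.subtypeL)
      (((contDiff_inhomogeneousSolution β 1).comp W.subtypeL.contDiff).clm_comp contDiff_const)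
      (fun c hc => (hRU (hsub ((hΓ c (hmemW c hc)).2.2 1))).2) hψd
  have h0δ : (0 : W) ∈ Metric.ball (0 : W) δ := by simpa using hδ
  have hψ0 : ψ 0 = o := by
    obtain ⟨h1, h2, -⟩ := hΓ ((0 : W) : V) (hmemW 0 h0δ)
    have h3 := eq_zero_of_norm_deriv_le (f := fun t => Γ ((0 : W) : V) t - o) (C := 0)
      (fun t ht => (h2 t ht).sub_const o) (fun t ht => by simp) (sub_eq_zero.2 h1) 1 (by simp)
    exact sub_eq_zero.1 h3
  have hfd0 : fderiv ℝ ψ 0 = (A o).comp W.subtypeL := by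
    rw [(hψd 0 h0δ).fderiv, hψ0]
    ext w
    simp [inhomogeneousSolution_at_zero]
  have hinj : Function.Injective (fderiv ℝ ψ 0) := by
    rw [hfd0]
    refine (injective_iff_map_eq_zero _).2 fun w hw => ?_
    have := Submodule.disjoint_def.1 hW.disjoint (w : V) hw w.2
    exact Subtype.ext this
  obtain ⟨ρ, hρ, hρδ, hsm, hT, hc⟩ := exists_isSubmanifold_image_ball hδ hψc hinj
  have hrank : Module.finrank ℝ W = Module.finrank ℝ (LinearMap.range (A o).toLinearMap) := by
    have h1 := LinearMap.finrank_range_add_finrank_ker (A o).toLinearMap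
    have h2 := Submodule.finrank_add_eq_of_isCompl hW
    omega
  refine ⟨ψ '' Metric.ball 0 ρ, hsm, ⟨0, by simpa using hρ, hψ0⟩, ?_, ?_⟩
  · rw [hψ0] at hT
    refine hT.trans ?_
    rw [hfd0]
    rintro - ⟨w, rfl⟩
    exact ⟨w, rfl⟩
  · rintro - ⟨c, hcρ, rfl⟩
    have hcδ := Metric.ball_subset_ball hρδ hcρ
    obtain ⟨hc1, hc2⟩ := hc c hcρ
    obtain ⟨h1, h2, h3⟩ := hΓ c (hmemW c hcδ)
    refine ⟨?_, c, Γ c, h1, rfl, h2, fun t _ => (hRU (hsub (h3 t))).1⟩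
    refine le_trans (le_of_eq ?_) hc2
    symm
    -- The derivative of `ψ` has values in the range of `A` and rank `dim W = rank A o`, which is at
    -- least the rank of `A` at the endpoint.
    refine Submodule.eq_of_le_of_finrank_le ?_ ?_
    · rw [(hψd c hcδ).fderiv]
      rintro - ⟨w, rfl⟩
      exact ⟨_, rfl⟩
    · rw [LinearMap.finrank_range_of_inj hc1, hrank]
      have := h2.finrank_range_le hb hβR fun t _ => hsub (h3 t)
      rwa [h1] at this

end Orbit

/-! ### Minimality implies generation. -/

section Necessity

open Set

variable {𝔤 : Type*} [LieRing 𝔤] [LieAlgebra ℝ 𝔤]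
  {E : Type*} [NormedAddCommGroup E] [NormedSpace ℂ E]
  {𝔮 : LieSubalgebra ℂ (ℂ ⊗[ℝ] 𝔤)} {Z : Set E} {o : E} {Ξ : (ℂ ⊗[ℝ] 𝔤) →ₗ[ℂ] (E → E)} {M : Set E}
  {V : Type*} [NormedAddCommGroup V] [NormedSpace ℝ V] [FiniteDimensional ℝ V]

/-- The real vector fields of the action, in linear coordinates `g : V → 𝔤`. -/
noncomputable def actionField (Ξ : (ℂ ⊗[ℝ] 𝔤) →ₗ[ℂ] (E → E)) (g : V →ₗ[ℝ] 𝔤) (x : E) : V →L[ℝ] E :=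
  LinearMap.toContinuousLinearMap (LinearMap.proj x ∘ₗ realAction Ξ ∘ₗ g)

theorem actionField_apply (g : V →ₗ[ℝ] 𝔤) (x : E) (v : V) :
    actionField Ξ g x v = realAction Ξ (g v) x := rfl

theorem IsAssociatedCRGerm.differentiableAt_realAction (hM : IsAssociatedCRGerm 𝔮 Z o Ξ M) (v : 𝔤)
    {x : E} (hx : x ∈ Z) : DifferentiableAt ℂ (realAction Ξ v) x :=
  (hM.model.holomorphic _ x hx).differentiableAt

/-- A bilinear map in coordinates for the bracket of a finite-dimensional Lie algebra. -/
theorem exists_bracket_coordinates {𝔟 : Type*} [LieRing 𝔟] [LieAlgebra ℝ 𝔟] (e : 𝔟 ≃ₗ[ℝ] V) :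
    ∃ β : V →L[ℝ] V →L[ℝ] V, ∀ v w, β v w = e ⁅e.symm v, e.symm w⁆ := by
  let β₀ : V →ₗ[ℝ] V →ₗ[ℝ] V := LinearMap.mk₂ ℝ (fun v w => e ⁅e.symm v, e.symm w⁆)
    (by simp) (by simp) (by simp) (by simp)
  exact ⟨LinearMap.toContinuousLinearMap (LinearMap.toContinuousLinearMap.toLinearMap ∘ₗ β₀),
    fun v w => rfl⟩

variable [FiniteDimensional ℂ E]

theorem IsAssociatedCRGerm.contDiffOn_actionField (hM : IsAssociatedCRGerm 𝔮 Z o Ξ M)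
    (g : V →ₗ[ℝ] 𝔤) : ContDiffOn ℝ ∞ (actionField Ξ g) Z :=
  contDiffOn_clm_apply.2 fun v x hx =>
    (((hM.model.contDiffAt ((1 : ℂ) ⊗ₜ[ℝ] g v) hx).restrict_scalars ℝ).of_le
      (by simp)).contDiffWithinAt

theorem IsAssociatedCRGerm.fderiv_actionField_apply (hM : IsAssociatedCRGerm 𝔮 Z o Ξ M)
    (g : V →ₗ[ℝ] 𝔤) {x : E} (hx : x ∈ Z) (h : E) (v : V) :
    fderiv ℝ (actionField Ξ g) x h v = fderiv ℝ (realAction Ξ (g v)) x h := by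
  have hd : DifferentiableAt ℝ (actionField Ξ g) x :=
    ((hM.contDiffOn_actionField g).contDiffAt (hM.model.isOpen.mem_nhds hx)).differentiableAt
      (by simp)
  have h1 := (hd.hasFDerivAt.clm_apply (hasFDerivAt_const v x)).fderiv
  have h2 : fderiv ℝ (fun y => actionField Ξ g y v) x h = fderiv ℝ (actionField Ξ g) x h v := by
    rw [h1]; simp
  exact h2.symm

theorem IsAssociatedCRGerm.bracketRelationAt (hM : IsAssociatedCRGerm 𝔮 Z o Ξ M)
    {g : V →ₗ[ℝ] 𝔤} {β : V →L[ℝ] V →L[ℝ] V} (hβ : ∀ v w, g (β v w) = ⁅g v, g w⁆)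
    {x : E} (hx : x ∈ Z) : BracketRelationAt (actionField Ξ g) β x := by
  intro v w
  rw [hM.fderiv_actionField_apply g hx, hM.fderiv_actionField_apply g hx, actionField_apply, hβ,
    hM.realAction_lie _ _ hx]
  rfl

/-- Elements whose value at the endpoint of a trajectory is a complex tangent vector are
transported back to the holomorphic part. -/
theorem IsAssociatedCRGerm.exp_neg_mem_holomorphicPart (hM : IsAssociatedCRGerm 𝔮 Z o Ξ M)
    {g : V →ₗ[ℝ] 𝔤} {β : V →L[ℝ] V →L[ℝ] V} (hβ : ∀ v w, g (β v w) = ⁅g v, g w⁆) {s : Set E}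
    (hsZ : s ⊆ Z) {C : ℝ} (hb : HasQuadraticBound (actionField Ξ g) s C) {u : V} {γ : ℝ → E}
    (hγ : IsTrajectory (actionField Ξ g) u γ) (h0 : γ 0 = o)
    (hs : ∀ t ∈ Icc (0 : ℝ) 1, γ t ∈ s) {v w : V}
    (hvw : Complex.I • actionField Ξ g (γ 1) v = actionField Ξ g (γ 1) w) :
    g (NormedSpace.exp (-β.flip u) v) ∈ holomorphicPart 𝔮 := by
  have : CompleteSpace V := FiniteDimensional.complete ℝ V
  set B := β.flip u with hB
  set A := actionField Ξ g with hA
  have hd : ∀ z : V, ∀ t ∈ Icc (0 : ℝ) 1, HasDerivWithinAt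
      (fun t => A (γ t) (NormedSpace.exp (t • B) z))
      (fderiv ℝ A (γ t) (A (γ t) (NormedSpace.exp (t • B) z)) u) (Icc 0 1) t := fun z t ht => by
    have := hγ.hasDerivWithinAt_apply (w := 0) ht (hb.differentiableAt _ (hs t ht))
      (hM.bracketRelationAt hβ (hsZ (hs t ht)))
      (by simpa [hB] using hasDerivAt_exp_smul_apply (β.flip u) z t)
    simpa [hB] using this
  let v₀ := NormedSpace.exp (-B) v
  let w₀ := NormedSpace.exp (-B) w
  have hback : ∀ z, NormedSpace.exp B (NormedSpace.exp (-B) z) = z := fun z => by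
    simpa using exp_neg_apply_exp_apply (-B) z
  -- The defect of the relation `i X_v = X_w` along `γ` obeys a linear equation, because the
  -- derivatives of holomorphic fields commute with `i`. It vanishes at time `1`, hence at time `0`.
  have key := eq_zero_left_of_norm_deriv_le
    (f := fun t => Complex.I • A (γ t) (NormedSpace.exp (t • B) v₀) -
      A (γ t) (NormedSpace.exp (t • B) w₀))
    (f' := fun t => Complex.I • fderiv ℝ A (γ t) (A (γ t) (NormedSpace.exp (t • B) v₀)) u -
      fderiv ℝ A (γ t) (A (γ t) (NormedSpace.exp (t • B) w₀)) u) (C := C * ‖u‖)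
    (fun t ht => ((hd v₀ t ht).const_smul Complex.I).sub (hd w₀ t ht))
    (fun t ht => by
      have h1 : Complex.I • fderiv ℝ A (γ t) (A (γ t) (NormedSpace.exp (t • B) v₀)) u -
          fderiv ℝ A (γ t) (A (γ t) (NormedSpace.exp (t • B) w₀)) u =
          fderiv ℝ A (γ t) (Complex.I • A (γ t) (NormedSpace.exp (t • B) v₀) -
            A (γ t) (NormedSpace.exp (t • B) w₀)) u := by
        rw [map_sub, _root_.sub_apply]
        simp only [hA, hM.fderiv_actionField_apply g (hsZ (hs t ht)),
          (hM.differentiableAt_realAction _ (hsZ (hs t ht))).fderiv_restrictScalars ℝ]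
        simp
      rw [h1]
      refine (ContinuousLinearMap.le_opNorm _ _).trans ?_
      calc _ ≤ (C * ‖Complex.I • A (γ t) (NormedSpace.exp (t • B) v₀) -
              A (γ t) (NormedSpace.exp (t • B) w₀)‖) * ‖u‖ := by
            gcongr
            refine (ContinuousLinearMap.le_opNorm _ _).trans ?_
            gcongr
            exact hb.norm_fderiv_le _ (hs t ht)
        _ = _ := by ring)
    (by simp [v₀, w₀, hback, hvw])
  simp only [zero_smul, NormedSpace.exp_zero, one_apply_eq_self, h0] at key
  refine mem_holomorphicPart_iff.2 ⟨g w₀, (hM.model.isotropy _).1 ?_⟩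
  rw [map_one_tmul_add_I_tmul]
  have h2 : Ξ ((1 : ℂ) ⊗ₜ[ℝ] g w₀) o = Complex.I • Ξ ((1 : ℂ) ⊗ₜ[ℝ] g v₀) o :=
    (sub_eq_zero.1 key).symm
  rw [h2, smul_smul, Complex.I_mul_I, neg_one_smul]
  exact add_neg_cancel _

theorem IsAssociatedCRGerm.lieSpan_eq_top [FiniteDimensional ℝ 𝔤]
    (hM : IsAssociatedCRGerm 𝔮 Z o Ξ M) (h : IsMinimalAt M o) :
    LieSubalgebra.lieSpan ℝ 𝔤 (holomorphicPart 𝔮 : Set 𝔤) = ⊤ := by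
  have : FiniteDimensional ℝ E := FiniteDimensional.complexToReal E
  set 𝔞 := LieSubalgebra.lieSpan ℝ 𝔤 (holomorphicPart 𝔮 : Set 𝔤) with h𝔞
  have hsub : ∀ v ∈ holomorphicPart 𝔮, v ∈ 𝔞 := fun v hv => LieSubalgebra.subset_lieSpan hv
  have : FiniteDimensional ℝ 𝔞 := inferInstanceAs (FiniteDimensional ℝ 𝔞.toSubmodule)
  have hZo := hM.model.isOpen.mem_nhds hM.model.base_mem
  -- Two coordinate systems: the orbit is built from `𝔞`, but its trajectories are reread in `𝔤`,
  -- because the elements transported along them are not yet known to lie in `𝔞`.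
  let e := (Module.finBasis ℝ 𝔤).equivFun
  let e' := (Module.finBasis ℝ 𝔞).equivFun
  obtain ⟨β, hβ⟩ := exists_bracket_coordinates e
  obtain ⟨β', hβ'⟩ := exists_bracket_coordinates e'
  let g := e.symm.toLinearMap
  let g' := 𝔞.toSubmodule.subtype ∘ₗ e'.symm.toLinearMap
  have hg : ∀ v w, g (β v w) = ⁅g v, g w⁆ := fun v w => by simp [g, hβ]
  have hg' : ∀ v w, g' (β' v w) = ⁅g' v, g' w⁆ := fun v w => by
    simp [g', hβ']
  have hAc := fun {x} (hx : x ∈ Z) =>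
    (hM.contDiffOn_actionField g).contDiffAt (hM.model.isOpen.mem_nhds hx)
  obtain ⟨R, hR, C, hRZ, hb⟩ :=
    exists_hasQuadraticBound ((hAc hM.model.base_mem).of_le two_le_infty) hZo
  obtain ⟨U, hU, hUM⟩ := hM.leaf.isSubmanifold.exists_forall_isTrajectory_mem (by simp)
    hM.leaf.base_mem (A := actionField Ξ g')
    (((hM.contDiffOn_actionField g').contDiffAt hZo).of_le (one_le_two.trans two_le_infty))
    (fun x hx v => (hM.mem_tangentSpaceAt hx).2 ⟨g' v, rfl⟩)
  obtain ⟨Y, hY, hoY, hTo, hTy⟩ := exists_isSubmanifold_orbit hM.model.isOpen hM.model.base_mem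
    (hM.contDiffOn_actionField g') (fun x hx => hM.bracketRelationAt hg' hx)
    (Filter.inter_mem hU (Metric.closedBall_mem_nhds o hR))
  have hYM : Y ⊆ M := fun y hy => by
    obtain ⟨-, u, γ, h0, h1, hγ, hmem⟩ := hTy y hy
    rw [← h1]
    exact hUM u γ hγ (h0 ▸ hM.leaf.base_mem) (fun t ht => (hmem t ht).1) 1 (by simp)
  have hHY : ∀ y ∈ Y, complexTangentSpaceAt M y ≤ tangentSpaceAt Y y := by
    intro y hy z hz
    obtain ⟨hrange, u, γ, h0, h1, hγ, hmem⟩ := hTy y hy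
    obtain ⟨v, hv⟩ := (hM.mem_tangentSpaceAt (hYM hy)).1 hz.1
    obtain ⟨w, hw⟩ := (hM.mem_tangentSpaceAt (hYM hy)).1 hz.2
    have hγ' : IsTrajectory (actionField Ξ g) (e (g' u)) γ := fun t ht => by
      have := hγ t ht
      simpa [actionField_apply, g] using this
    have h2 := hM.exp_neg_mem_holomorphicPart hg hRZ hb hγ' h0 (fun t ht => (hmem t ht).2)
      (v := e v) (w := e w) (by
        simp only [actionField_apply, g, h1, LinearEquiv.coe_coe, LinearEquiv.symm_apply_apply,
          realAction_apply, hv, hw]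
        rfl)
    -- The generator of the trajectory lies in `𝔞`, so the exponential of bracketing with it
    -- preserves `𝔞`.
    have h3 : NormedSpace.exp (β.flip (e (g' u))) (NormedSpace.exp (-β.flip (e (g' u))) (e v)) ∈
        𝔞.toSubmodule.comap g := by
      refine exp_apply_mem (Submodule.closed_of_finiteDimensional _) (fun x hx => ?_) (hsub _ h2)
      rw [Submodule.mem_comap, ContinuousLinearMap.flip_apply, hg]
      refine 𝔞.lie_mem hx ?_
      simp [g, g']
    have h4 : v ∈ 𝔞 := by
      have h5 := exp_neg_apply_exp_apply (-β.flip (e (g' u))) (e v)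
      rw [neg_neg] at h5
      rw [h5] at h3
      simpa [g] using h3
    refine hrange ⟨e' ⟨v, h4⟩, ?_⟩
    rw [← hv]
    simp [actionField_apply, g', realAction_apply]
  have hT := h Y hYM hY hoY hHY
  refine eq_top_iff.2 fun v _ => ?_
  have h1 : Ξ ((1 : ℂ) ⊗ₜ[ℝ] v) o ∈ tangentSpaceAt Y o := by
    rw [hT]
    exact (hM.mem_tangentSpaceAt hM.leaf.base_mem).2 ⟨v, rfl⟩
  obtain ⟨a, ha⟩ := hTo h1
  -- The difference is a real isotropy element, so the imaginary part can be taken to be `0`.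
  have h2 : v - g' a ∈ holomorphicPart 𝔮 := by
    refine mem_holomorphicPart_iff.2 ⟨0, (hM.model.isotropy _).1 ?_⟩
    rw [TensorProduct.tmul_zero, add_zero, TensorProduct.tmul_sub, map_sub, Pi.sub_apply, ← ha]
    exact sub_self _
  have h3 := 𝔞.add_mem (hsub _ h2) (e'.symm a).2
  simpa [g'] using h3

end Necessity

end CRAlg

theorem theorem5p5
    {𝔤 : Type*} [LieRing 𝔤] [LieAlgebra ℝ 𝔤] [FiniteDimensional ℝ 𝔤]
    (𝔮 : LieSubalgebra ℂ (ℂ ⊗[ℝ] 𝔤))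
    {E : Type*} [NormedAddCommGroup E] [NormedSpace ℂ E] [FiniteDimensional ℂ E]
    (Z : Set E) (o : E) (Ξ : (ℂ ⊗[ℝ] 𝔤) →ₗ[ℂ] (E → E)) (M : Set E)
    (hM : CRAlg.IsAssociatedCRGerm 𝔮 Z o Ξ M) :
    CRAlg.IsMinimalAt M o ↔
      LieSubalgebra.lieSpan ℝ 𝔤 (CRAlg.holomorphicPart 𝔮 : Set 𝔤) = ⊤ :=
  ⟨hM.lieSpan_eq_top, hM.isMinimalAt⟩
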